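/- **Theorem (Conditional second-order convergence of the $\theta$-RK-2 method).** *Setting.* Let $\mathbb X=(\mathbb Z/S)^d$ ($S\ge 1$) be the discrete torus, $\mathbb D=\mathbb X\setminus\{0\}$ its set of jumps, $\gamma$ the counting measure on $\mathbb D$, $0\le\delta<T$, and let $(p_t)_{0\le t\le T}$ be the marginal laws of a forward continuous-time Markov chain on $\mathbb X$: probability vectors with $\frac{d}{dt}p_t=Q_tp_t$, where $Q_t(y,x)\ge 0$ for $y\ne x$ is the rate of jumping from $x$ to $y$ and $Q_t(x,x)=-\sum_{y\neq x}Q_t(y,x)$. Assume that $p_t(x)>0$ for all $x\in\mathbb X$ and $t\in[\delta,T]$, and that a fixed probability vector $p_\infty$ is the unique stationary distribution of $Q_t$ for each $t\in[\delta,T]$. Let $\widehat s_t(x,y)$ be an estimate of the score $s_t(x,y)=p_t(y)/p_t(x)$. For $s\in[0,T-\delta]$, $\nu\in\mathbb D$, $y\in\mathbb X$ put $$\mu_s(\nu,y)=s_{T-s}(y,y+\nu)\,Q_{T-s}(y,y+\nu),\qquad \widehat\mu_s(\nu,y)=\widehat s_{T-s}(y,y+\nu)\,Q_{T-s}(y,y+\nu).$$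 Let $0=s_0<\dots<s_N=T-\delta$, $\Delta_n=s_{n+1}-s_n$, $\kappa=\max_n\Delta_n$, $\theta\in(0,\frac12]$ and $\rho_n=(1-\theta)s_n+\theta s_{n+1}$. *Sampler.* Start from $\widehat y_{0}\sim p_\infty$. For $n=0,\dots,N-1$ draw, with independent Poisson variables $\mathcal P(\cdot)$ of the indicated means, $$\widehat y^*_{\rho_n}=\widehat y_{s_n}+\sum_{\nu\in\mathbb D}\nu\,\mathcal P\big(\widehat\mu_{s_n}(\nu,\widehat y_{s_n})\theta\Delta_n\big),\qquad \widehat y_{s_{n+1}}=\widehat y_{s_n}+\sum_{\nu\in\mathbb D}\nu\,\mathcal P\big(\lambda_n(\nu)\Delta_n\big),$$ where, with $\widehat\mu^{\mathrm{RK}}_n(\nu)=(1-\frac1{2\theta})\widehat\mu_{s_n}(\nu,\widehat y_{s_n})+\frac1{2\theta}\widehat\mu_{\rho_n}(\nu,\widehat y^*_{\rho_n})$, one takes either $\lambda_n(\nu)=\mathbf 1_{\{\widehat\mu_{s_n}(\nu,\widehat y_{s_n})>0\}}[\widehat\mu^{\mathrm{RK}}_n(\nu)]_+$ (the algorithm)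 or $\lambda_n(\nu)=\widehat\mu_n^{\mathrm{RK}}(\nu)$ (the interpolating process given by the stochastic integral $\widehat y_s=\widehat y_0+\int_0^s\int_{\mathbb D}\nu\,N[\widehat\mu^{\mathrm{RK}}](ds,d\nu)$, at the grid times). Let $\widehat q^{\mathrm{RK}}_{T-\delta}$ be the law of $\widehat y_{s_N}$. *Assumptions.* 1. $D_{\mathrm{KL}}(p_T\|p_\infty)\le C_0e^{-T}$. 2. For every $(\nu,y)$ with $\mu_s(\nu,y)\,p_{T-s}(y)>0$ for some $s\in[0,T-\delta]$, both $s\mapsto\mu_s(\nu,y)$ and $s\mapsto\widehat\mu_s(\nu,y)$ are $C^2$ on $[0,T-\delta]$, take values in $[m,M]$ with $m>0$, and have first and second derivatives bounded by $M$. 3. For every $s\in\bigcup_{n<N}\{s_n,\rho_n\}$ and $y\sim p_{T-s}$, $$\mathbb E\sum_{\nu\in\mathbb D}\Big(\mu_s(\nu,y)\Big(\log\frac{\mu_s(\nu,y)}{\widehat\mu_s(\nu,y)}-1\Big)+\widehat\mu_s(\nu,y)\Big)\le\epsilon_{\mathrm I},\qquad \mathbb E\sum_{\nu\in\mathbb D}|\mu_s(\nu,y)-\widehat\mu_s(\nu,y)|\le\epsilon_{\mathrm{II}}.$$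 4. Almost surely along the sampler, $\widehat\mu^{\mathrm{RK}}_n(\nu)\ge0$ for all $\nu\in\mathbb D$ and $n<N$. *Conclusion.* There is a constant $C>0$ depending only on $S,d,p_\infty,\theta,m,M,C_0$ (not on $T,\delta$, the grid, $\kappa$, $\epsilon_{\mathrm I},\epsilon_{\mathrm{II}}$, the forward process or the estimated score) such that, for either version of the sampler, $$D_{\mathrm{KL}}\big(p_\delta\,\big\|\,\widehat q^{\mathrm{RK}}_{T-\delta}\big)\le C\big(e^{-T}+(\epsilon_{\mathrm I}+\epsilon_{\mathrm{II}})T+\kappa^2T\big).$$ -/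

import Mathlib

open MeasureTheory ProbabilityTheory InformationTheory Set
open scoped ENNReal NNReal Matrix

noncomputable section

namespace ThetaRK

/-- The state space `[S]^d` with periodic boundary condition, i.e. the discrete torus. -/
abbrev State (S d : ℕ) : Type := Fin d → ZMod S

/-- The pairwise difference set `{x - y : x ≠ y}` of the state space, i.e. the nonzero elements of
the torus. -/
abbrev Jump (S d : ℕ) : Type := {ν : State S d // ν ≠ 0}

section Forward

variable {S d : ℕ} [NeZero S]

/-- `A y x` is the rate of jumping from `x` to `y`: off-diagonal entries are nonnegative and every
column sums to zero. -/
def IsRateMatrix (A : Matrix (State S d) (State S d) ℝ) : Prop :=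
  (∀ x, A x x = -∑ y ∈ Finset.univ.erase x, A y x) ∧ ∀ x y, x ≠ y → 0 ≤ A x y

/-- `p t`, `0 ≤ t ≤ T`, are the marginal laws of the forward continuous-time Markov chain with rate
matrices `Q t`: they are probability vectors and solve `dp/dt = Q p`. -/
def IsForwardProcess (T : ℝ) (Q : ℝ → Matrix (State S d) (State S d) ℝ)
    (p : ℝ → State S d → ℝ) : Prop :=
  (∀ t ∈ Icc 0 T, IsRateMatrix (Q t)) ∧
  (∀ t ∈ Icc 0 T, p t ∈ stdSimplex ℝ (State S d)) ∧
  ∀ t ∈ Icc 0 T, HasDerivWithinAt p (Q t *ᵥ p t) (Icc 0 T) t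

/-- `π` is the unique probability vector annihilated by the rate matrix `A`. -/
def IsUniqueStationary (A : Matrix (State S d) (State S d) ℝ) (π : State S d → ℝ) : Prop :=
  ∀ v ∈ stdSimplex ℝ (State S d), A *ᵥ v = 0 ↔ v = π

/-- The measure on the state space with the given vector of point masses. -/
def toMeasure (v : State S d → ℝ) : Measure (State S d) :=
  ∑ x, ENNReal.ofReal (v x) • Measure.dirac x

/-- The score function `s_t(x, y) = p_t(y) / p_t(x)`. -/
def score (p : ℝ → State S d → ℝ) (t : ℝ) (x y : State S d) : ℝ := p t y / p t x

/-- The intensity at backward time `s` of the jump `ν` from the state `y` that belongs to a score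
`sc` (true or estimated): `sc_{T-s}(y, y + ν) Q_{T-s}(y, y + ν)`. -/
def intensity (T : ℝ) (Q : ℝ → Matrix (State S d) (State S d) ℝ)
    (sc : ℝ → State S d → State S d → ℝ) (s : ℝ) (ν : Jump S d) (y : State S d) : ℝ :=
  sc (T - s) y (y + ν) * Q (T - s) y (y + ν)

/-- `f` is `C²` on `[0, L]`, with values in `[m, M]` and first and second derivatives bounded
by `M`. -/
def RegularOn (m M L : ℝ) (f : ℝ → ℝ) : Prop :=
  ContDiffOn ℝ 2 f (Icc 0 L) ∧
  ∀ s ∈ Icc 0 L, m ≤ f s ∧ f s ≤ M ∧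
    |derivWithin f (Icc 0 L) s| ≤ M ∧ |iteratedDerivWithin 2 f (Icc 0 L) s| ≤ M

/-- Regularity of the intensities: for every state `y` and jump `ν` charged by the measure
`μ_s(ν, y) γ(dν) p_{T-s}(dy)` at some backward time `s ∈ [0, T - δ]`, both the true intensity `μ`
and the estimated intensity `μh` are `C²` in time and bounded above and below on `[0, T - δ]`. -/
def RegularIntensities (m M T δ : ℝ) (p : ℝ → State S d → ℝ)
    (μ μh : ℝ → Jump S d → State S d → ℝ) : Prop :=
  ∀ (ν : Jump S d) (y : State S d), (∃ s ∈ Icc 0 (T - δ), 0 < μ s ν y * p (T - s) y) →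
    RegularOn m M (T - δ) (fun s => μ s ν y) ∧ RegularOn m M (T - δ) (fun s => μh s ν y)

/-- The estimation error in the (generalized Kullback-Leibler) score entropy at time `s`, with
`y ∼ p_{T-s}`. -/
def entropyError (T : ℝ) (p : ℝ → State S d → ℝ)
    (μ μh : ℝ → Jump S d → State S d → ℝ) (s : ℝ) : ℝ :=
  ∑ y, p (T - s) y *
    ∑ ν : Jump S d, (μ s ν y * (Real.log (μ s ν y / μh s ν y) - 1) + μh s ν y)

/-- The estimation error in absolute value at time `s`, with `y ∼ p_{T-s}`. -/
def absError (T : ℝ) (p : ℝ → State S d → ℝ)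
    (μ μh : ℝ → Jump S d → State S d → ℝ) (s : ℝ) : ℝ :=
  ∑ y, p (T - s) y * ∑ ν : Jump S d, |μ s ν y - μh s ν y|

end Forward

section Sampler

variable {S d : ℕ} [NeZero S]

/-- `0 = s 0 < s 1 < ... < s N = L`. -/
def IsGrid (L : ℝ) (N : ℕ) (s : ℕ → ℝ) : Prop :=
  s 0 = 0 ∧ s N = L ∧ ∀ n < N, s n < s (n + 1)

/-- The `θ`-section point `ρ_n = (1 - θ) s_n + θ s_{n+1}`. -/
def sectionPoint (θ : ℝ) (s : ℕ → ℝ) (n : ℕ) : ℝ := (1 - θ) * s n + θ * s (n + 1)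

/-- The estimation errors are at most `ε₁` and `ε₂` at all grid points and section points. -/
def EstimationErrorLE (ε₁ ε₂ T θ : ℝ) (N : ℕ) (s : ℕ → ℝ) (p : ℝ → State S d → ℝ)
    (μ μh : ℝ → Jump S d → State S d → ℝ) : Prop :=
  ∀ n < N, ∀ r, r = s n ∨ r = sectionPoint θ s n →
    entropyError T p μ μh r ≤ ε₁ ∧ absError T p μ μh r ≤ ε₂

/-- The law of `y + ∑_ν ν P(a_ν)`, where `P(a_ν)` are independent Poisson variables with means
`a_ν` (negative means are replaced by `0`). -/
def leap (y : State S d) (a : Jump S d → ℝ) : Measure (State S d) :=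
  (Measure.pi fun ν : Jump S d => poissonMeasure (a ν).toNNReal).map
    fun k => y + ∑ ν : Jump S d, k ν • (ν : State S d)

/-- First stage: the law of the intermediate state `y*` at `ρ_n`, obtained from the state `y` at
time `s_n` by `τ`-leaping over a time `θ Δ_n` with the intensity `μh` frozen at `s_n`. -/
def stageOne (μh : ℝ → Jump S d → State S d → ℝ) (θ : ℝ) (s : ℕ → ℝ) (n : ℕ)
    (y : State S d) : Measure (State S d) :=
  leap y fun ν => μh (s n) ν y * (θ * (s (n + 1) - s n))

/-- The weighted sum `(1 - 1/(2θ)) μh_{s_n}(ν, y) + (1/(2θ)) μh_{ρ_n}(ν, y*)`, which is the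
intensity of the interpolating process on `(s_n, s_{n+1}]`. -/
def combinedIntensity (μh : ℝ → Jump S d → State S d → ℝ) (θ : ℝ) (s : ℕ → ℝ) (n : ℕ)
    (y ystar : State S d) (ν : Jump S d) : ℝ :=
  (1 - 1 / (2 * θ)) * μh (s n) ν y + 1 / (2 * θ) * μh (sectionPoint θ s n) ν ystar

open Classical in
/-- The second stage intensity `1_{μh_{s_n} > 0} [combined intensity]₊` of the algorithm. -/
def algorithmIntensity (μh : ℝ → Jump S d → State S d → ℝ) (θ : ℝ) (s : ℕ → ℝ) (n : ℕ)
    (y ystar : State S d) (ν : Jump S d) : ℝ :=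
  if 0 < μh (s n) ν y then max 0 (combinedIntensity μh θ s n y ystar ν) else 0

/-- The law at grid time `s_n` of the two-stage scheme with initial law `q₀` and second-stage
intensity `rate n y y*`: given `y` at time `s_n`, draw `y*` by the first stage; then, given `y`
and `y*`, add to `y` jumps `ν` in independent Poisson numbers of means `rate n y y* ν * Δ_n`. -/
def twoStageLaw (μh : ℝ → Jump S d → State S d → ℝ) (θ : ℝ) (s : ℕ → ℝ)
    (rate : ℕ → State S d → State S d → Jump S d → ℝ) (q₀ : Measure (State S d)) :
    ℕ → Measure (State S d)
  | 0 => q₀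
  | n + 1 => (twoStageLaw μh θ s rate q₀ n).bind fun y =>
      (stageOne μh θ s n y).bind fun ystar =>
        leap y fun ν => rate n y ystar ν * (s (n + 1) - s n)

/-- The law of the output of the `θ`-RK-2 algorithm after `n` steps. -/
def algorithmLaw (μh : ℝ → Jump S d → State S d → ℝ) (θ : ℝ) (s : ℕ → ℝ)
    (q₀ : Measure (State S d)) (n : ℕ) : Measure (State S d) :=
  twoStageLaw μh θ s (algorithmIntensity μh θ s) q₀ n

/-- The law at grid time `s_n` of the interpolating process
`y_s = y_0 + ∫_0^s ∫ ν N[combined intensity](ds, dν)`. Given `y` at time `s_n` and `y*`, this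
intensity is constant on `(s_n, s_{n+1}]`, so the numbers of jumps `ν` in this interval are
independent Poisson variables with means `combined intensity * Δ_n`. -/
def interpolatingLaw (μh : ℝ → Jump S d → State S d → ℝ) (θ : ℝ) (s : ℕ → ℝ)
    (q₀ : Measure (State S d)) (n : ℕ) : Measure (State S d) :=
  twoStageLaw μh θ s (combinedIntensity μh θ s) q₀ n

/-- Almost surely the combined intensity is nonnegative in every step, along a scheme whose law at
time `s_n` is `law n`. -/
def CombinedIntensityNonneg (μh : ℝ → Jump S d → State S d → ℝ) (θ : ℝ) (N : ℕ) (s : ℕ → ℝ)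
    (law : ℕ → Measure (State S d)) : Prop :=
  ∀ n < N, ∀ᵐ y ∂(law n), ∀ᵐ ystar ∂(stageOne μh θ s n y), ∀ ν,
    0 ≤ combinedIntensity μh θ s n y ystar ν

end Sampler

end ThetaRK

end

open ThetaRK

/-!
The divergence at the final time is bounded by a χ²-divergence between the laws at the grid times,
so that no path measures enter. Write `q_n` for the backward marginal `p (T - s_n)`, `r_n` for the
law of the sampler at `s_n`, and `P_n` for the transition matrix of its `n`-th step, so that
`r_{n+1} = r_n P_n`.

*Uniform ergodicity.* A jump has either intensity at least `m` at all times or intensity zero at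
all times, and so has its estimate. Stationarity and uniqueness of the positive vector `pinf` make
the graph of the former jumps strongly connected (`exists_pos_rate_of_isUniqueStationary`). Hence,
if all steps are small, `r_n` is bounded below by a constant that does not depend on the time
(`le_sum_of_isCutConnected`), and a step `P_n` of length `Δ` contracts the χ²-divergence by a
factor `1 - b Δ` (`chiSq_push_le`).

*Local errors.* Both `q_{n+1}` and `q_n P_n` agree with their first-order expansions in `Δ` up to
`O(Δ²)`: the former by the master equation (`abs_sub_sub_drift_le`); the latter because the first
stage moves `y*` away from `y` with probability `O(Δ)` only, while for `y* = y` the combined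
intensity is the one at `s_n` up to `O(Δ)` (`firstOrder_sub_le_twoStage`). The expansions differ
by `Δ` times the absolute estimation error `A_n`. So `q_{n+1} - q_n P_n = O(Δ (Δ + A_n))`
(`abs_sub_push_stepMatrix_le`).

*Accumulation.* In `χ²(q_{n+1}, r_{n+1})` the local error enters through its square and, as the
contraction absorbs the cross term, divided by `Δ` (`chiSq_step`). The increase per step is thus
`O(Δ (Δ + A_n)²)`, which sums up to `O(T (κ² + ε₂))` as `A_n` is bounded. The initial
χ²-divergence is `O(exp (-T))` by comparison of both divergences with the Hellinger distance
(`chiSq_le_sum_klFun`).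

*Large steps.* If `κ` is not small, the trivial bound `r_n ≥ c exp (-C s_n)` gives a divergence of
order `1 + T`, which is at most of order `exp (-T) + κ² T`.

Both versions of the sampler are covered, since their intensities have the same upper bound and
agree with the estimate at `y* = y` in the same sense (`IsSecondStage`); the Poisson means that
define the laws are clipped at zero.
-/

namespace ThetaRK

/-! ### Finite Markov chains and the χ²-divergence -/

/-- The χ²-functional `∑ e² / r`. For `e = q - r` this is the χ²-divergence of `q` from `r`. -/
noncomputable def chiSq {X : Type*} [Fintype X] (e r : X → ℝ) : ℝ := ∑ x, e x ^ 2 / r x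

/-- The push-forward of the (signed) vector `v` under the kernel `P`, where `P y x` is the
probability of moving from `y` to `x`. -/
def push {X : Type*} [Fintype X] (P : X → X → ℝ) (v : X → ℝ) (x : X) : ℝ := ∑ y, v y * P y x

/-- `P` is a stochastic matrix, with rows indexed by the starting point. -/
def IsStochastic {X : Type*} [Fintype X] (P : X → X → ℝ) : Prop :=
  (∀ y x, 0 ≤ P y x) ∧ ∀ y, ∑ x, P y x = 1

/-- Strong connectedness of the directed graph `E`, in terms of cuts: every nonempty proper set of
vertices is entered by an edge. -/
def IsCutConnected {X : Type*} [Fintype X] (E : X → X → Prop) : Prop :=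
  ∀ B : Finset X, B.Nonempty → B ≠ Finset.univ → ∃ y, y ∉ B ∧ ∃ x ∈ B, E y x

section Markov

variable {X : Type*} [Fintype X]

/-- A function that varies by at most `g` along each edge varies by at most `|X| g` in all: grow a
set from `x₀` by one state at a time. -/
lemma IsCutConnected.abs_sub_le {E : X → X → Prop} (hE : IsCutConnected E) {h : X → ℝ} {g : ℝ}
    (hg0 : 0 ≤ g) (hg : ∀ y x, y ≠ x → E y x → |h y - h x| ≤ g) (x x₀ : X) :
    |h x - h x₀| ≤ Fintype.card X * g := by
  classical
  have key : ∀ k : ℕ, k + 1 ≤ Fintype.card X → ∃ B : Finset X, x₀ ∈ B ∧ k + 1 ≤ B.card ∧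
      ∀ z ∈ B, |h z - h x₀| ≤ (k + 1 : ℕ) * g := by
    intro k
    induction k with
    | zero => exact fun _ => ⟨{x₀}, by simp, by simp, by simpa using hg0⟩
    | succ k ih =>
      intro hk
      obtain ⟨B, hx₀, hcard, hB⟩ := ih (by omega)
      by_cases hBu : B = Finset.univ
      · refine ⟨B, hx₀, by rw [hBu, Finset.card_univ]; exact hk, fun z hz => (hB z hz).trans ?_⟩
        gcongr
        omega
      · obtain ⟨y, hy, z, hz, hyz⟩ := hE B ⟨x₀, hx₀⟩ hBu
        refine ⟨insert y B, by simp [hx₀], by rw [Finset.card_insert_of_notMem hy]; omega, ?_⟩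
        intro u hu
        rcases Finset.mem_insert.1 hu with rfl | hu
        · have h1 := hg u z (fun h => hy (h ▸ hz)) hyz
          have h2 := _root_.abs_sub_le (h u) (h z) (h x₀)
          have h3 := hB z hz
          push_cast at h3 ⊢
          linarith
        · have h3 := hB u hu
          push_cast at h3 ⊢
          linarith
  have hpos : 0 < Fintype.card X := Fintype.card_pos_iff.2 ⟨x₀⟩
  obtain ⟨B, -, hcard, hB⟩ := key (Fintype.card X - 1) (by omega)
  rw [Nat.sub_add_cancel hpos] at hcard hB
  have hBu : B = Finset.univ := (Finset.card_eq_iff_eq_univ B).1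
    (le_antisymm (Finset.card_le_univ B) hcard)
  exact hB x (hBu ▸ Finset.mem_univ x)

lemma chiSq_nonneg {e r : X → ℝ} (hr : ∀ x, 0 ≤ r x) : 0 ≤ chiSq e r :=
  Finset.sum_nonneg fun x _ => div_nonneg (sq_nonneg _) (hr x)

lemma push_pos {P : X → X → ℝ} (hP : IsStochastic P) {r : X → ℝ} (hr : ∀ x, 0 < r x)
    {x : X} (hx : 0 < P x x) : 0 < push P r x :=
  (mul_pos (hr x) hx).trans_le (Finset.single_le_sum (f := fun y => r y * P y x)
    (fun y _ => mul_nonneg (hr y).le (hP.1 y x)) (Finset.mem_univ x))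

/-- The loss of χ²-divergence under a stochastic matrix is a sum of conditional variances. -/
lemma chiSq_sub_chiSq_push {P : X → X → ℝ} (hP : IsStochastic P) {e r : X → ℝ}
    (hr : ∀ x, 0 < r x) (hr' : ∀ x, 0 < push P r x) :
    chiSq e r - chiSq (push P e) (push P r) =
      ∑ x, ∑ y, r y * P y x * (e y / r y - push P e x / push P r x) ^ 2 := by
  have h1 : ∀ x, ∑ y, r y * P y x * (e y / r y - push P e x / push P r x) ^ 2 =
      ∑ y, e y ^ 2 / r y * P y x - push P e x ^ 2 / push P r x := by
    intro x
    set b := push P e x / push P r x with hb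
    have h2 : ∀ y, r y * P y x * (e y / r y - b) ^ 2 =
        e y ^ 2 / r y * P y x - 2 * b * (e y * P y x) + b ^ 2 * (r y * P y x) := by
      intro y
      have := (hr y).ne'
      field_simp
      ring
    simp_rw [h2]
    rw [Finset.sum_add_distrib, Finset.sum_sub_distrib, ← Finset.mul_sum, ← Finset.mul_sum]
    change _ - 2 * b * push P e x + b ^ 2 * push P r x = _
    have := (hr' x).ne'
    rw [hb]
    field_simp
    ring
  simp_rw [h1]
  rw [Finset.sum_sub_distrib, Finset.sum_comm]
  simp_rw [← Finset.mul_sum, hP.2, mul_one]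
  rfl

/-- Contraction of the χ²-divergence, from the conditional variances carried by the edges and a
Poincaré inequality on the graph of edges. -/
lemma chiSq_push_le {E : X → X → Prop} (hE : IsCutConnected E) {P : X → X → ℝ}
    (hP : IsStochastic P) {e r : X → ℝ} {c η : ℝ} (hc : 0 < c) (hη : 0 < η) (hη2 : η ≤ 1 / 2)
    (hr : ∀ x, c ≤ r x) (hr1 : ∑ x, r x = 1) (he : ∑ x, e x = 0)
    (hstay : ∀ x, 1 / 2 ≤ P x x) (hedge : ∀ y x, y ≠ x → E y x → η ≤ P y x) :
    chiSq (push P e) (push P r) ≤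
      (1 - c * η / (2 * (Fintype.card X : ℝ) ^ 2)) * chiSq e r := by
  classical
  have hr0 : ∀ x, 0 < r x := fun x => hc.trans_le (hr x)
  have hr' : ∀ x, 0 < push P r x := fun x =>
    push_pos hP hr0 (lt_of_lt_of_le (by norm_num) (hstay x))
  obtain ⟨x₁⟩ : Nonempty X := by
    by_contra h
    rw [not_nonempty_iff] at h
    simp at hr1
  set D := chiSq e r - chiSq (push P e) (push P r) with hD
  have hDeq := chiSq_sub_chiSq_push hP (e := e) hr0 hr'
  rw [← hD] at hDeq
  set h : X → ℝ := fun y => e y / r y with hh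
  have hterm : ∀ x y, 0 ≤ r y * P y x * (h y - push P e x / push P r x) ^ 2 := fun x y =>
    mul_nonneg (mul_nonneg (hr0 y).le (hP.1 y x)) (sq_nonneg _)
  have hD0 : 0 ≤ D := by
    rw [hDeq]
    exact Finset.sum_nonneg fun x _ => Finset.sum_nonneg fun y _ => hterm x y
  have hedgeD : ∀ y x, y ≠ x → E y x → (h y - h x) ^ 2 ≤ 2 * D / (c * η) := by
    intro y x hyx hyE
    set b := push P e x / push P r x with hb
    have h1 : r y * P y x * (h y - b) ^ 2 + r x * P x x * (h x - b) ^ 2 ≤ D := by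
      rw [hDeq]
      refine le_trans ?_ (Finset.single_le_sum
        (f := fun x => ∑ y, r y * P y x * (h y - push P e x / push P r x) ^ 2)
        (fun x _ => Finset.sum_nonneg fun y _ => hterm x y) (Finset.mem_univ x))
      rw [← Finset.sum_pair (f := fun y => r y * P y x * (h y - b) ^ 2) hyx]
      exact Finset.sum_le_sum_of_subset_of_nonneg (Finset.subset_univ _) fun z _ _ => hterm x z
    have h2 : c * η ≤ r y * P y x := mul_le_mul (hr y) (hedge y x hyx hyE) hη.le (hr0 y).le
    have h3 : c * η ≤ r x * P x x :=
      mul_le_mul (hr x) (hη2.trans (hstay x)) hη.le (hr0 x).le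
    rw [le_div_iff₀ (by positivity)]
    have h4 := mul_le_mul_of_nonneg_right h2 (sq_nonneg (h y - b))
    have h5 := mul_le_mul_of_nonneg_right h3 (sq_nonneg (h x - b))
    have h6 : (h y - h x) ^ 2 ≤ 2 * ((h y - b) ^ 2 + (h x - b) ^ 2) := by
      nlinarith [sq_nonneg ((h y - b) + (h x - b))]
    have h7 := mul_le_mul_of_nonneg_right h6 (mul_pos hc hη).le
    linarith
  set g := Real.sqrt (2 * D / (c * η)) with hg
  have hg2 : g ^ 2 = 2 * D / (c * η) := Real.sq_sqrt (by positivity)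
  have hrange : ∀ x x', (h x - h x') ^ 2 ≤ (Fintype.card X : ℝ) ^ 2 * g ^ 2 := by
    intro x x'
    rw [← mul_pow]
    exact sq_le_sq' (abs_le.1 (hE.abs_sub_le (Real.sqrt_nonneg _)
      (fun y x hyx hyE => Real.abs_le_sqrt (hedgeD y x hyx hyE)) x x')).1
      (abs_le.1 (hE.abs_sub_le (Real.sqrt_nonneg _)
      (fun y x hyx hyE => Real.abs_le_sqrt (hedgeD y x hyx hyE)) x x')).2
  have hrh : ∀ y, r y * h y = e y := fun y => by
    have := (hr0 y).ne'
    simp only [hh]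
    field_simp
  have hchi : chiSq e r = ∑ y, r y * h y ^ 2 := by
    refine Finset.sum_congr rfl fun y _ => ?_
    have := (hr0 y).ne'
    simp only [hh]
    field_simp
  have hmean : ∀ y, h y ^ 2 ≤ ∑ z, r z * (h y - h z) ^ 2 := by
    intro y
    have h1 : ∑ z, r z * (h y - h z) ^ 2 = h y ^ 2 + chiSq e r := by
      have h2 : ∀ z, r z * (h y - h z) ^ 2 =
          h y ^ 2 * r z - 2 * h y * e z + r z * h z ^ 2 := fun z => by rw [← hrh z]; ring
      simp_rw [h2]
      rw [Finset.sum_add_distrib, Finset.sum_sub_distrib, ← Finset.mul_sum, ← Finset.mul_sum,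
        hr1, he, hchi]
      ring
    rw [h1]
    linarith [chiSq_nonneg (e := e) fun x => (hr0 x).le]
  have hchi_le : chiSq e r ≤ (Fintype.card X : ℝ) ^ 2 * g ^ 2 := by
    have h1 : ∀ y, h y ^ 2 ≤ (Fintype.card X : ℝ) ^ 2 * g ^ 2 := by
      intro y
      refine (hmean y).trans ?_
      calc ∑ z, r z * (h y - h z) ^ 2
          ≤ ∑ z, r z * ((Fintype.card X : ℝ) ^ 2 * g ^ 2) :=
            Finset.sum_le_sum fun z _ => mul_le_mul_of_nonneg_left (hrange y z) (hr0 z).le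
        _ = _ := by rw [← Finset.sum_mul, hr1, one_mul]
    rw [hchi]
    calc ∑ y, r y * h y ^ 2 ≤ ∑ y, r y * ((Fintype.card X : ℝ) ^ 2 * g ^ 2) :=
          Finset.sum_le_sum fun y _ => mul_le_mul_of_nonneg_left (h1 y) (hr0 y).le
      _ = _ := by rw [← Finset.sum_mul, hr1, one_mul]
  have hn : (0 : ℝ) < Fintype.card X := by exact_mod_cast Fintype.card_pos_iff.2 ⟨x₁⟩
  have hfin : c * η / (2 * (Fintype.card X : ℝ) ^ 2) * chiSq e r ≤ D := by
    calc c * η / (2 * (Fintype.card X : ℝ) ^ 2) * chiSq e r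
        ≤ c * η / (2 * (Fintype.card X : ℝ) ^ 2) * ((Fintype.card X : ℝ) ^ 2 * g ^ 2) := by gcongr
      _ = D := by rw [hg2]; field_simp
  linarith

/-- One step of a perturbed chain: the contraction absorbs the cross term, so that the error `ζ`
enters quadratically and is divided by the size `η` of the edge probabilities only once. -/
lemma chiSq_step {E : X → X → Prop} (hE : IsCutConnected E) {P : X → X → ℝ}
    (hP : IsStochastic P) {e r ζ : X → ℝ} {c η Z : ℝ} (hc : 0 < c) (hη : 0 < η) (hη2 : η ≤ 1 / 2)
    (hr : ∀ x, c ≤ r x) (hr' : ∀ x, c ≤ push P r x) (hr1 : ∑ x, r x = 1) (he : ∑ x, e x = 0)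
    (hstay : ∀ x, 1 / 2 ≤ P x x) (hedge : ∀ y x, y ≠ x → E y x → η ≤ P y x)
    (hζ : ∀ x, |ζ x| ≤ Z) :
    chiSq (push P e + ζ) (push P r) ≤
      chiSq e r + 4 * (Fintype.card X : ℝ) ^ 3 / (c ^ 2 * η) * Z ^ 2 := by
  obtain ⟨x₁⟩ : Nonempty X := by
    by_contra h
    rw [not_nonempty_iff] at h
    simp at hr1
  have hn : (1 : ℝ) ≤ Fintype.card X := by exact_mod_cast Fintype.card_pos_iff.2 ⟨x₁⟩
  have hc1 : c ≤ 1 := by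
    rw [← hr1]
    exact (hr x₁).trans (Finset.single_le_sum (fun y _ => hc.le.trans (hr y)) (Finset.mem_univ x₁))
  have hcontr := chiSq_push_le hE hP hc hη hη2 hr hr1 he hstay hedge
  set t := c * η / (2 * (Fintype.card X : ℝ) ^ 2) with ht
  have ht0 : 0 < t := by positivity
  have ht1 : t ≤ 1 := by
    rw [ht, div_le_one (by positivity)]
    nlinarith
  have hφ := chiSq_nonneg (e := e) (r := r) fun x => hc.le.trans (hr x)
  have hsplit : chiSq (push P e + ζ) (push P r) ≤
      (1 + t) * chiSq (push P e) (push P r) + (1 + 1 / t) * ∑ _x : X, Z ^ 2 / c := by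
    unfold chiSq
    rw [Finset.mul_sum, Finset.mul_sum, ← Finset.sum_add_distrib]
    refine Finset.sum_le_sum fun x _ => ?_
    have hx : 0 < push P r x := hc.trans_le (hr' x)
    have h1 : (push P e x + ζ x) ^ 2 ≤ (1 + t) * push P e x ^ 2 + (1 + 1 / t) * ζ x ^ 2 := by
      have h2 : (1 + t) * push P e x ^ 2 + (1 + 1 / t) * ζ x ^ 2 - (push P e x + ζ x) ^ 2 =
          (t * push P e x - ζ x) ^ 2 / t := by
        field_simp
        ring
      have : 0 ≤ (t * push P e x - ζ x) ^ 2 / t := by positivity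
      linarith
    have h3 : ζ x ^ 2 / push P r x ≤ Z ^ 2 / c := by
      have := sq_le_sq' (abs_le.1 (hζ x)).1 (abs_le.1 (hζ x)).2
      exact div_le_div₀ (sq_nonneg _) this hc (hr' x)
    calc (push P e + ζ) x ^ 2 / push P r x
        ≤ ((1 + t) * push P e x ^ 2 + (1 + 1 / t) * ζ x ^ 2) / push P r x := by
          gcongr
          exact h1
      _ = (1 + t) * (push P e x ^ 2 / push P r x) + (1 + 1 / t) * (ζ x ^ 2 / push P r x) := by
          ring
      _ ≤ _ := by gcongr
  have h1 : (1 + t) * chiSq (push P e) (push P r) ≤ chiSq e r := by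
    calc (1 + t) * chiSq (push P e) (push P r) ≤ (1 + t) * ((1 - t) * chiSq e r) := by gcongr
      _ = chiSq e r - t ^ 2 * chiSq e r := by ring
      _ ≤ _ := by linarith [mul_nonneg (sq_nonneg t) hφ]
  have h2 : (1 + 1 / t) * ∑ _x : X, Z ^ 2 / c ≤
      4 * (Fintype.card X : ℝ) ^ 3 / (c ^ 2 * η) * Z ^ 2 := by
    have h3 : 1 + 1 / t ≤ 2 / t := by
      rw [le_div_iff₀ ht0]
      field_simp
      linarith
    rw [Finset.sum_const, Finset.card_univ, nsmul_eq_mul]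
    calc (1 + 1 / t) * (Fintype.card X * (Z ^ 2 / c)) ≤ 2 / t * (Fintype.card X * (Z ^ 2 / c)) := by
          gcongr
      _ = _ := by rw [ht]; field_simp; ring
  linarith

/-- Uniform lower bound for a time-inhomogeneous chain whose one-step probabilities are at least
`a Δ` on the edges and at least `1 - b Δ` on the diagonal. The set `B` of states gains mass from
some state `z ∉ B` with an edge into `B`, and the mass of `z` is what `B ∪ {z}` has in excess of
`B`; hence the induction on the number of states outside `B`. -/
lemma le_sum_of_isCutConnected {E : X → X → Prop} (hE : IsCutConnected E) {N : ℕ}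
    {P : ℕ → X → X → ℝ} {r : ℕ → X → ℝ} {Δ : ℕ → ℝ} {a b c₀ : ℝ} (ha : 0 < a) (hb : 0 ≤ b)
    (hc₀ : 0 ≤ c₀) (hr0 : ∀ n ≤ N, ∀ x, 0 ≤ r n x) (hr1 : ∀ n ≤ N, ∑ x, r n x = 1)
    (hinit : ∀ x, c₀ ≤ r 0 x) (hstep : ∀ n < N, ∀ x, r (n + 1) x = push (P n) (r n) x)
    (hP : ∀ n < N, IsStochastic (P n)) (hΔ : ∀ n < N, 0 ≤ Δ n)
    (hΔ1 : ∀ n < N, (a + b) * Δ n ≤ 1)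
    (hstay : ∀ n < N, ∀ x, 1 - b * Δ n ≤ P n x x)
    (hedge : ∀ n < N, ∀ y x, y ≠ x → E y x → a * Δ n ≤ P n y x) :
    ∀ j : ℕ, ∀ B : Finset X, B.Nonempty → Fintype.card X ≤ B.card + j → ∀ n ≤ N,
      c₀ * (a / (a + b)) ^ j ≤ ∑ x ∈ B, r n x := by
  classical
  have hab : 0 < a + b := by linarith
  have hβ0 : 0 ≤ a / (a + b) := by positivity
  have hβ1 : a / (a + b) ≤ 1 := by rw [div_le_one hab]; linarith
  have hinitB : ∀ B : Finset X, B.Nonempty → c₀ ≤ ∑ x ∈ B, r 0 x := by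
    rintro B ⟨x, hx⟩
    exact (hinit x).trans (Finset.single_le_sum (fun y _ => hr0 0 (Nat.zero_le _) y) hx)
  intro j
  induction j with
  | zero =>
    intro B hB hcard n hn
    have hBu : B = Finset.univ := (Finset.card_eq_iff_eq_univ B).1
      (le_antisymm (Finset.card_le_univ B) (by simpa using hcard))
    have := hinitB B hB
    rw [hBu] at this ⊢
    rw [hr1 0 (Nat.zero_le _)] at this
    rw [hr1 n hn]
    simpa using this
  | succ j ih =>
    intro B hB hcard n
    by_cases hBu : B = Finset.univ
    · intro hn
      refine le_trans ?_ (ih B hB (by rw [hBu, Finset.card_univ]; omega) n hn)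
      rw [pow_succ]
      exact mul_le_mul_of_nonneg_left (mul_le_of_le_one_right (by positivity) hβ1) hc₀
    obtain ⟨z, hz, x₀, hx₀, hzx⟩ := hE B hB hBu
    have hne : z ≠ x₀ := fun h => hz (h ▸ hx₀)
    induction n with
    | zero =>
      intro _
      exact (mul_le_of_le_one_right hc₀ (pow_le_one₀ hβ0 hβ1)).trans (hinitB B hB)
    | succ n ihn =>
      intro hn
      have hnN : n < N := hn
      have hold := ihn hnN.le
      have hbig := ih (insert z B) (Finset.insert_nonempty _ _)
        (by rw [Finset.card_insert_of_notMem hz]; omega) n hnN.le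
      rw [Finset.sum_insert hz] at hbig
      -- Within `B` the mass stays put up to a factor; on top of this comes the edge `z → x₀`.
      have hlow : ∑ x ∈ B, (r n x * P n x x + if x = x₀ then r n z * P n z x₀ else 0) ≤
          ∑ x ∈ B, r (n + 1) x := by
        refine Finset.sum_le_sum fun x hx => ?_
        rw [hstep n hnN x]
        have hnn : ∀ y, 0 ≤ r n y * P n y x := fun y =>
          mul_nonneg (hr0 n hnN.le y) ((hP n hnN).1 y x)
        by_cases hxx : x = x₀
        · subst hxx
          rw [if_pos rfl, add_comm,
            ← Finset.sum_pair (f := fun y => r n y * P n y x) hne]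
          exact Finset.sum_le_sum_of_subset_of_nonneg (Finset.subset_univ _) fun y _ _ => hnn y
        · rw [if_neg hxx, add_zero]
          exact Finset.single_le_sum (f := fun y => r n y * P n y x) (fun y _ => hnn y)
            (Finset.mem_univ x)
      rw [Finset.sum_add_distrib, Finset.sum_ite_eq' B x₀, if_pos hx₀] at hlow
      have h1 : (1 - b * Δ n) * ∑ x ∈ B, r n x ≤ ∑ x ∈ B, r n x * P n x x := by
        rw [Finset.mul_sum]
        refine Finset.sum_le_sum fun x _ => ?_
        rw [mul_comm]
        exact mul_le_mul_of_nonneg_left (hstay n hnN x) (hr0 n hnN.le x)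
      have h2 : a * Δ n * r n z ≤ r n z * P n z x₀ := by
        rw [mul_comm]
        exact mul_le_mul_of_nonneg_left (hedge n hnN z x₀ hne hzx) (hr0 n hnN.le z)
      set β := a / (a + b) with hβ
      set R := ∑ x ∈ B, r n x with hR
      have h3 : (a + b) * (c₀ * β ^ (j + 1)) = a * (c₀ * β ^ j) := by
        rw [pow_succ, hβ]
        field_simp
      have h4 : a * Δ n * (c₀ * β ^ j - R) ≤ a * Δ n * r n z :=
        mul_le_mul_of_nonneg_left (by linarith) (mul_nonneg ha.le (hΔ n hnN))
      have h5 := mul_le_mul_of_nonneg_left hold (sub_nonneg.2 (hΔ1 n hnN))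
      have h6 : (1 - (a + b) * Δ n) * (c₀ * β ^ (j + 1)) + a * Δ n * (c₀ * β ^ j) =
          c₀ * β ^ (j + 1) := by
        linear_combination -Δ n * h3
      have h7 : (1 - b * Δ n) * R + a * Δ n * (c₀ * β ^ j - R) =
          (1 - (a + b) * Δ n) * R + a * Δ n * (c₀ * β ^ j) := by ring
      linarith

end Markov

/-! ### Poisson leaps and the one-step kernel of the sampler -/

section Finite

variable {X : Type*} [Fintype X] [MeasurableSpace X] [MeasurableSingletonClass X]

lemma sum_measureReal_singleton_eq_one (μ : Measure X) [IsProbabilityMeasure μ] :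
    ∑ x, μ.real {x} = 1 := by
  rw [sum_measureReal_singleton, Finset.coe_univ, probReal_univ]

lemma bind_real_singleton (μ : Measure X) [IsProbabilityMeasure μ] (k : X → Measure X)
    [∀ y, IsProbabilityMeasure (k y)] (x : X) :
    (μ.bind k).real {x} = push (fun y x => (k y).real {x}) (fun y => μ.real {y}) x := by
  rw [measureReal_def, Measure.bind_apply (measurableSet_singleton x)
    (measurable_of_finite k).aemeasurable, lintegral_fintype, ENNReal.toReal_sum]
  · refine Finset.sum_congr rfl fun y _ => ?_
    rw [ENNReal.toReal_mul, mul_comm]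
    rfl
  · exact fun y _ => ENNReal.mul_ne_top (measure_ne_top _ _) (measure_ne_top _ _)

lemma isProbabilityMeasure_bind_of_finite (μ : Measure X) [IsProbabilityMeasure μ]
    (k : X → Measure X) [∀ y, IsProbabilityMeasure (k y)] : IsProbabilityMeasure (μ.bind k) :=
  isProbabilityMeasure_bind (measurable_of_finite k).aemeasurable
    (Filter.Eventually.of_forall fun _ => inferInstance)

end Finite

section Leap

variable {S d : ℕ}

/-- The extension by zero to the whole torus of a function on the nonzero jumps. -/
noncomputable def extendZero (a : Jump S d → ℝ) (z : State S d) : ℝ :=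
  if h : z ≠ 0 then a ⟨z, h⟩ else 0

lemma extendZero_zero (a : Jump S d → ℝ) : extendZero a 0 = 0 := by simp [extendZero]

lemma extendZero_coe (a : Jump S d → ℝ) (ν : Jump S d) : extendZero a (ν : State S d) = a ν := by
  simp [extendZero, ν.2]

variable [NeZero S]

lemma sum_extendZero (a : Jump S d → ℝ) : ∑ z, extendZero a z = ∑ ν, a ν := by
  classical
  rw [← Fintype.sum_subtype_add_sum_subtype (fun z : State S d => z ≠ 0) (extendZero a)]
  have h : ∑ z : {z : State S d // ¬ z ≠ 0}, extendZero a z = 0 :=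
    Finset.sum_eq_zero fun z _ => by simp [extendZero, z.2]
  rw [h, add_zero]
  exact Finset.sum_congr rfl fun ν _ => extendZero_coe a ν

lemma sum_extendZero_sub (a : Jump S d → ℝ) (y : State S d) :
    ∑ x, extendZero a (x - y) = ∑ ν, a ν := by
  rw [← sum_extendZero a]
  exact Fintype.sum_equiv (Equiv.subRight y) _ _ fun _ => rfl

lemma measurable_leap_map (y : State S d) :
    Measurable fun k : Jump S d → ℕ => y + ∑ ν : Jump S d, k ν • (ν : State S d) :=
  measurable_of_countable _

instance isProbabilityMeasure_leap (y : State S d) (a : Jump S d → ℝ) :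
    IsProbabilityMeasure (leap y a) :=
  Measure.isProbabilityMeasure_map (measurable_leap_map y).aemeasurable

lemma pi_poisson_le_leap (y : State S d) (a : Jump S d → ℝ) (k : Jump S d → ℕ) :
    ∏ ν, (Real.exp (-max (a ν) 0) * max (a ν) 0 ^ k ν / (k ν).factorial) ≤
      (leap y a).real {y + ∑ ν : Jump S d, k ν • (ν : State S d)} := by
  have h1 : (Measure.pi fun ν : Jump S d => poissonMeasure (a ν).toNNReal).real {k} =
      ∏ ν, (Real.exp (-max (a ν) 0) * max (a ν) 0 ^ k ν / (k ν).factorial) := by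
    rw [measureReal_def, Measure.pi_singleton, ENNReal.toReal_prod]
    refine Finset.prod_congr rfl fun ν _ => ?_
    rw [← measureReal_def, poissonMeasure_real_singleton, Real.coe_toNNReal']
  rw [← h1, leap, map_measureReal_apply (measurable_leap_map y) (measurableSet_singleton _)]
  exact measureReal_mono (by simp)

lemma exp_neg_le_leap_self (y : State S d) (a : Jump S d → ℝ) :
    Real.exp (-∑ ν, max (a ν) 0) ≤ (leap y a).real {y} := by
  have h := pi_poisson_le_leap y a 0
  simpa [← Real.exp_sum] using h

lemma exp_neg_mul_le_leap_add (y : State S d) (a : Jump S d → ℝ) (ν : Jump S d) :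
    Real.exp (-∑ ν, max (a ν) 0) * max (a ν) 0 ≤ (leap y a).real {y + ν} := by
  classical
  have h := pi_poisson_le_leap y a (Pi.single ν 1)
  have h1 : ∑ ν' : Jump S d, (Pi.single ν 1 : Jump S d → ℕ) ν' • (ν' : State S d) = ν := by
    rw [Finset.sum_eq_single ν (fun b _ hb => by simp [hb]) (by simp)]
    simp
  rw [h1] at h
  refine le_trans (le_of_eq ?_) h
  rw [← Finset.sum_neg_distrib, Real.exp_sum]
  simp_rw [mul_div_assoc]
  rw [Finset.prod_mul_distrib]
  congr 1
  rw [Finset.prod_eq_single ν (fun b _ hb => by simp [hb]) (by simp)]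
  simp

/-- One step of a two-stage scheme started at `y`: draw `y*` by a leap with means `α`, then leap
from `y` with means `b y*`. -/
noncomputable def twoStage (y : State S d) (α : Jump S d → ℝ) (b : State S d → Jump S d → ℝ) :
    Measure (State S d) :=
  (leap y α).bind fun ystar => leap y (b ystar)

instance isProbabilityMeasure_twoStage (y : State S d) (α : Jump S d → ℝ)
    (b : State S d → Jump S d → ℝ) : IsProbabilityMeasure (twoStage y α b) :=
  isProbabilityMeasure_bind_of_finite _ _

lemma twoStage_real_singleton (y : State S d) (α : Jump S d → ℝ) (b : State S d → Jump S d → ℝ)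
    (x : State S d) :
    (twoStage y α b).real {x} = ∑ z, (leap y α).real {z} * (leap y (b z)).real {x} :=
  bind_real_singleton _ _ _

lemma sum_max_le {a : Jump S d → ℝ} {B : ℝ} (hB : 0 ≤ B) (ha : ∀ ν, a ν ≤ B) :
    ∑ ν, max (a ν) 0 ≤ Fintype.card (Jump S d) * B := by
  calc ∑ ν, max (a ν) 0 ≤ ∑ _ν : Jump S d, B := Finset.sum_le_sum fun ν _ => max_le (ha ν) hB
    _ = _ := by simp

lemma exp_neg_le_twoStage_self (y : State S d) (α : Jump S d → ℝ) {b : State S d → Jump S d → ℝ}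
    {B : ℝ} (hB : 0 ≤ B) (hb : ∀ z ν, b z ν ≤ B) :
    Real.exp (-(Fintype.card (Jump S d) * B)) ≤ (twoStage y α b).real {y} := by
  rw [twoStage_real_singleton]
  calc Real.exp (-(Fintype.card (Jump S d) * B))
      = ∑ z, (leap y α).real {z} * Real.exp (-(Fintype.card (Jump S d) * B)) := by
        rw [← Finset.sum_mul, sum_measureReal_singleton_eq_one, one_mul]
    _ ≤ _ := by
        refine Finset.sum_le_sum fun z _ => mul_le_mul_of_nonneg_left ?_ measureReal_nonneg
        refine le_trans (Real.exp_le_exp.2 ?_) (exp_neg_le_leap_self y (b z))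
        exact neg_le_neg (sum_max_le hB (hb z))

/-- The first-order expansion of the one-step probabilities: stay with probability `1 - ∑ g`, jump
by `ν` with probability `g ν`. -/
noncomputable def firstOrder (g : Jump S d → ℝ) (y x : State S d) : ℝ :=
  (if x = y then 1 - ∑ ν, g ν else 0) + extendZero g (x - y)

lemma sum_firstOrder (g : Jump S d → ℝ) (y : State S d) : ∑ x, firstOrder g y x = 1 := by
  simp [firstOrder, Finset.sum_add_distrib, sum_extendZero_sub]

/-- A two-stage step agrees with its first-order expansion up to a quadratic error, from below. The
first stage changes the state with a probability of first order only, so that the second-stage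
means matter, to this order, at `y* = y` alone. -/
lemma firstOrder_sub_le_twoStage {y : State S d} {α : Jump S d → ℝ}
    {b : State S d → Jump S d → ℝ} {g : Jump S d → ℝ} {B σ : ℝ} (hB : 0 ≤ B)
    (hα : ∀ ν, α ν ≤ B) (hb : ∀ z ν, b z ν ≤ B) (hσ : ∀ ν, |max (b y ν) 0 - g ν| ≤ σ)
    (hσ0 : 0 ≤ σ) (x : State S d) :
    firstOrder g y x - ((Fintype.card (Jump S d) + 1) * σ +
      (Fintype.card (Jump S d) ^ 2 + 2 * Fintype.card (Jump S d)) * B ^ 2) ≤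
      (twoStage y α b).real {x} := by
  classical
  set K : ℝ := (Fintype.card (Jump S d) : ℝ) with hK
  have hK0 : 0 ≤ K := by positivity
  have hstay1 : 1 - K * B ≤ (leap y α).real {y} := by
    refine le_trans ?_ (exp_neg_le_leap_self y α)
    have := Real.add_one_le_exp (-∑ ν, max (α ν) 0)
    linarith [sum_max_le hB hα]
  have hg : ∑ ν, max (b y ν) 0 ≤ ∑ ν, g ν + K * σ := by
    have : ∑ ν, max (b y ν) 0 ≤ ∑ ν, (g ν + σ) :=
      Finset.sum_le_sum fun ν _ => by linarith [(abs_le.1 (hσ ν)).2]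
    rwa [Finset.sum_add_distrib, Finset.sum_const, Finset.card_univ, nsmul_eq_mul] at this
  rw [twoStage_real_singleton]
  by_cases hxy : x = y
  · subst hxy
    rw [firstOrder, if_pos rfl, sub_self, extendZero_zero, add_zero]
    have h1 : ∑ z, (leap x α).real {z} * (1 - ∑ ν, max (b z ν) 0) ≤
        ∑ z, (leap x α).real {z} * (leap x (b z)).real {x} := by
      refine Finset.sum_le_sum fun z _ => mul_le_mul_of_nonneg_left ?_ measureReal_nonneg
      refine le_trans ?_ (exp_neg_le_leap_self x (b z))
      linarith [Real.add_one_le_exp (-∑ ν, max (b z ν) 0)]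
    have h2 : ∑ z, (leap x α).real {z} * (∑ ν, max (b z ν) 0) ≤
        ∑ ν, max (b x ν) 0 + K * B * (K * B) := by
      have h3 : ∀ z, (leap x α).real {z} * (∑ ν, max (b z ν) 0) ≤
          (leap x α).real {z} * (K * B) + if z = x then
            (leap x α).real {x} * (∑ ν, max (b x ν) 0 - K * B) else 0 := by
        intro z
        by_cases hz : z = x
        · subst hz
          rw [if_pos rfl]
          linarith
        · rw [if_neg hz, add_zero]
          exact mul_le_mul_of_nonneg_left (sum_max_le hB (hb z)) measureReal_nonneg
      refine (Finset.sum_le_sum fun z _ => h3 z).trans ?_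
      rw [Finset.sum_add_distrib, ← Finset.sum_mul, sum_measureReal_singleton_eq_one,
        Finset.sum_ite_eq' Finset.univ x, if_pos (Finset.mem_univ x)]
      have h4 : (1 - (leap x α).real {x}) * (K * B - ∑ ν, max (b x ν) 0) ≤ K * B * (K * B) := by
        have h5 : 0 ≤ 1 - (leap x α).real {x} := sub_nonneg.2 measureReal_le_one
        have h6 : 0 ≤ ∑ ν, max (b x ν) 0 := Finset.sum_nonneg fun ν _ => le_max_right _ _
        exact mul_le_mul (by linarith) (by linarith)
          (by linarith [sum_max_le hB (hb x)]) (by positivity)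
      linarith
    simp_rw [mul_sub, mul_one] at h1
    rw [Finset.sum_sub_distrib, sum_measureReal_singleton_eq_one] at h1
    have h7 : 0 ≤ K * B ^ 2 := by positivity
    linarith
  · have hne : x - y ≠ 0 := sub_ne_zero.2 hxy
    set ν : Jump S d := ⟨x - y, hne⟩ with hν
    have hx : x = y + ν := by simp [hν]
    have hE : extendZero g (x - y) = g ν := extendZero_coe g ν
    rw [firstOrder, if_neg hxy, zero_add, hE]
    have h1 : (leap y α).real {y} * (leap y (b y)).real {x} ≤
        ∑ z, (leap y α).real {z} * (leap y (b z)).real {x} :=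
      Finset.single_le_sum (f := fun z => (leap y α).real {z} * (leap y (b z)).real {x})
        (fun z _ => mul_nonneg measureReal_nonneg measureReal_nonneg) (Finset.mem_univ y)
    have h2 : Real.exp (-(K * B)) ≤ (leap y α).real {y} :=
      le_trans (Real.exp_le_exp.2 (neg_le_neg (sum_max_le hB hα))) (exp_neg_le_leap_self y α)
    have hm0 : 0 ≤ max (b y ν) 0 := le_max_right _ _
    have h3 : Real.exp (-(K * B)) * max (b y ν) 0 ≤ (leap y (b y)).real {x} := by
      rw [hx]
      refine le_trans ?_ (exp_neg_mul_le_leap_add y (b y) ν)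
      exact mul_le_mul_of_nonneg_right
        (Real.exp_le_exp.2 (neg_le_neg (sum_max_le hB (hb y)))) hm0
    have h4 : (1 - 2 * (K * B)) * max (b y ν) 0 ≤
        (leap y α).real {y} * (leap y (b y)).real {x} := by
      calc (1 - 2 * (K * B)) * max (b y ν) 0
          ≤ Real.exp (-(2 * (K * B))) * max (b y ν) 0 := by
            refine mul_le_mul_of_nonneg_right ?_ hm0
            linarith [Real.add_one_le_exp (-(2 * (K * B)))]
        _ = Real.exp (-(K * B)) * (Real.exp (-(K * B)) * max (b y ν) 0) := by
            rw [← mul_assoc (Real.exp _), ← Real.exp_add]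
            ring_nf
        _ ≤ _ := mul_le_mul h2 h3 (mul_nonneg (Real.exp_pos _).le hm0) measureReal_nonneg
    have h5 : 2 * (K * B) * max (b y ν) 0 ≤ 2 * (K * B) * B :=
      mul_le_mul_of_nonneg_left (max_le (hb y ν) hB) (by positivity)
    have h6 := (abs_le.1 (hσ ν)).1
    have h7 : 0 ≤ K * σ := by positivity
    have h8 : 0 ≤ K ^ 2 * B ^ 2 := by positivity
    linarith

/-- The two-sided version: both sides of the lower bound have total mass one up to the error. -/
lemma abs_twoStage_sub_firstOrder_le {y : State S d} {α : Jump S d → ℝ}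
    {b : State S d → Jump S d → ℝ} {g : Jump S d → ℝ} {D : ℝ}
    (h : ∀ x, firstOrder g y x - D ≤ (twoStage y α b).real {x}) (x : State S d) :
    |(twoStage y α b).real {x} - firstOrder g y x| ≤ Fintype.card (State S d) * D := by
  have h0 : ∀ x, 0 ≤ (twoStage y α b).real {x} - firstOrder g y x + D := fun x => by
    linarith [h x]
  have h1 : ∑ x, ((twoStage y α b).real {x} - firstOrder g y x + D) =
      Fintype.card (State S d) * D := by
    rw [Finset.sum_add_distrib, Finset.sum_sub_distrib, sum_measureReal_singleton_eq_one,
      sum_firstOrder]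
    simp
  have h2 := Finset.single_le_sum (fun x _ => h0 x) (Finset.mem_univ x)
  rw [h1] at h2
  have h3 : (0 : ℝ) ≤ Fintype.card (State S d) * D := (h0 x).trans h2
  have h4 : 0 ≤ D := by
    by_contra hD
    have : (0 : ℝ) < Fintype.card (State S d) := by exact_mod_cast Fintype.card_pos
    nlinarith
  have h5 : D ≤ Fintype.card (State S d) * D :=
    le_mul_of_one_le_left h4 (by exact_mod_cast Nat.one_le_iff_ne_zero.2 Fintype.card_ne_zero)
  exact abs_le.2 ⟨by linarith [h0 x], by linarith⟩

end Leap

/-! ### Kullback–Leibler divergence on a finite space -/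

section KL

lemma klFun_le_sq {x : ℝ} (hx : 0 ≤ x) : klFun x ≤ (x - 1) ^ 2 := by
  rcases hx.eq_or_lt with rfl | hx
  · simp [klFun_zero]
  · rw [klFun_apply]
    nlinarith [mul_le_mul_of_nonneg_left (Real.log_le_sub_one_of_pos hx) hx.le]

/-- Pointwise comparison of the Kullback–Leibler and Hellinger integrands. -/
lemma sq_sqrt_sub_one_le_klFun {x : ℝ} (hx : 0 ≤ x) : (Real.sqrt x - 1) ^ 2 ≤ klFun x := by
  have hu : 0 ≤ Real.sqrt x := Real.sqrt_nonneg x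
  have h1 : klFun x - (Real.sqrt x - 1) ^ 2 = 2 * Real.sqrt x * klFun (Real.sqrt x) := by
    rw [klFun_apply, klFun_apply, Real.log_sqrt hx]
    have := Real.sq_sqrt hx
    linear_combination (1 - Real.log x) * this
  have h2 := mul_nonneg (mul_nonneg zero_le_two hu) (klFun_nonneg hu)
  linarith

/-- A converse of `klDiv_le_chiSq` for a reference vector that is bounded below. -/
lemma chiSq_le_sum_klFun {X : Type*} [Fintype X] {v w : X → ℝ} {c : ℝ} (hc : 0 < c)
    (hw : ∀ x, c ≤ w x)
    (hw1 : ∀ x, w x ≤ 1) (hv : ∀ x, 0 ≤ v x) (hv1 : ∀ x, v x ≤ 1) :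
    chiSq (fun x => v x - w x) w ≤ 4 / c * ∑ x, w x * klFun (v x / w x) := by
  unfold chiSq
  rw [Finset.mul_sum]
  refine Finset.sum_le_sum fun x _ => ?_
  have hx : 0 < w x := hc.trans_le (hw x)
  set u := v x / w x with hu
  have hu0 : 0 ≤ u := div_nonneg (hv x) hx.le
  have h1 : (v x - w x) ^ 2 / w x = w x * ((Real.sqrt u + 1) ^ 2 * (Real.sqrt u - 1) ^ 2) := by
    have h2 : (Real.sqrt u + 1) * (Real.sqrt u - 1) = u - 1 := by
      linear_combination Real.sq_sqrt hu0
    rw [← mul_pow, h2, hu]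
    field_simp
  have h3 : (Real.sqrt u + 1) ^ 2 ≤ 4 / c := by
    have h4 : u ≤ 1 / c := div_le_div₀ zero_le_one (hv1 x) hc (hw x)
    have h5 : 1 ≤ 1 / c := by
      rw [le_div_iff₀ hc]
      linarith [hw x, hw1 x]
    have h6 : (Real.sqrt u + 1) ^ 2 ≤ 2 * (u + 1) := by
      nlinarith [Real.sq_sqrt hu0, sq_nonneg (Real.sqrt u - 1)]
    calc (Real.sqrt u + 1) ^ 2 ≤ 2 * (1 / c + 1 / c) := by linarith
      _ = 4 / c := by ring
  rw [h1, mul_left_comm (4 / c)]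
  exact mul_le_mul_of_nonneg_left
    (mul_le_mul h3 (sq_sqrt_sub_one_le_klFun hu0) (sq_nonneg _) (by positivity)) hx.le

variable {X : Type*} [Fintype X] [MeasurableSpace X] [MeasurableSingletonClass X]

lemma klDiv_eq_ofReal_sum (μ ν : Measure X) [IsFiniteMeasure μ] [IsFiniteMeasure ν]
    (hν : ∀ x, 0 < ν.real {x}) :
    klDiv μ ν = ENNReal.ofReal (∑ x, ν.real {x} * klFun (μ.real {x} / ν.real {x})) := by
  have hac : μ ≪ ν := by
    refine Measure.AbsolutelyContinuous.mk fun s _ hs => ?_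
    have : s = ∅ := by
      refine Set.eq_empty_of_forall_notMem fun x hx => (hν x).ne' ?_
      rw [measureReal_def, measure_mono_null (Set.singleton_subset_iff.2 hx) hs]
      rfl
    rw [this, measure_empty]
  have hrn : ∀ x, (μ.rnDeriv ν x).toReal = μ.real {x} / ν.real {x} := by
    intro x
    have h1 : μ {x} = μ.rnDeriv ν x * ν {x} := by
      conv_lhs => rw [← Measure.withDensity_rnDeriv_eq μ ν hac]
      rw [withDensity_apply _ (measurableSet_singleton x), lintegral_singleton]
    rw [eq_div_iff (hν x).ne', measureReal_def, measureReal_def, h1, ENNReal.toReal_mul]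
  rw [klDiv_eq_lintegral_klFun_of_ac hac, lintegral_fintype,
    ENNReal.ofReal_sum_of_nonneg fun x _ => mul_nonneg measureReal_nonneg
      (klFun_nonneg (div_nonneg measureReal_nonneg measureReal_nonneg))]
  refine Finset.sum_congr rfl fun x _ => ?_
  rw [hrn x, mul_comm, ENNReal.ofReal_mul measureReal_nonneg, ofReal_measureReal]

lemma klDiv_le_chiSq (μ ν : Measure X) [IsFiniteMeasure μ] [IsFiniteMeasure ν]
    (hν : ∀ x, 0 < ν.real {x}) :
    klDiv μ ν ≤ ENNReal.ofReal
      (chiSq (fun x => μ.real {x} - ν.real {x}) fun x => ν.real {x}) := by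
  rw [klDiv_eq_ofReal_sum μ ν hν]
  refine ENNReal.ofReal_le_ofReal (Finset.sum_le_sum fun x _ => ?_)
  have hx := (hν x).ne'
  calc ν.real {x} * klFun (μ.real {x} / ν.real {x})
      ≤ ν.real {x} * (μ.real {x} / ν.real {x} - 1) ^ 2 :=
        mul_le_mul_of_nonneg_left
          (klFun_le_sq (div_nonneg measureReal_nonneg measureReal_nonneg)) measureReal_nonneg
    _ = _ := by field_simp

lemma klDiv_le_neg_log (μ ν : Measure X) [IsProbabilityMeasure μ] [IsProbabilityMeasure ν]
    {c : ℝ} (hc : 0 < c) (hν : ∀ x, c ≤ ν.real {x}) :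
    klDiv μ ν ≤ ENNReal.ofReal (-Real.log c) := by
  rw [klDiv_eq_ofReal_sum μ ν fun x => hc.trans_le (hν x)]
  refine ENNReal.ofReal_le_ofReal ?_
  have h1 : ∀ x, ν.real {x} * klFun (μ.real {x} / ν.real {x}) ≤
      μ.real {x} * (-Real.log c) + ν.real {x} - μ.real {x} := by
    intro x
    have hx : 0 < ν.real {x} := hc.trans_le (hν x)
    have h2 : ν.real {x} * klFun (μ.real {x} / ν.real {x}) =
        μ.real {x} * Real.log (μ.real {x} / ν.real {x}) + ν.real {x} - μ.real {x} := by
      rw [klFun_apply]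
      field_simp
    rw [h2]
    rcases (measureReal_nonneg (μ := μ) (s := {x})).eq_or_lt with h0 | h0
    · simp [← h0]
    · have h3 : Real.log (μ.real {x} / ν.real {x}) ≤ -Real.log c := by
        rw [Real.log_div h0.ne' hx.ne']
        linarith [Real.log_nonpos h0.le measureReal_le_one, Real.log_le_log hc (hν x)]
      linarith [mul_le_mul_of_nonneg_left h3 h0.le]
  refine (Finset.sum_le_sum fun x _ => h1 x).trans ?_
  rw [Finset.sum_sub_distrib, Finset.sum_add_distrib, ← Finset.sum_mul,
    sum_measureReal_singleton_eq_one, sum_measureReal_singleton_eq_one]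
  linarith

end KL

section ToMeasure

variable {S d : ℕ} [NeZero S]

lemma toMeasure_real_singleton {v : State S d → ℝ} (hv : ∀ x, 0 ≤ v x) (x : State S d) :
    (toMeasure v).real {x} = v x := by
  classical
  rw [measureReal_def, toMeasure, Measure.finsetSum_apply]
  simp only [Measure.smul_apply, smul_eq_mul, Measure.dirac_apply' _ (measurableSet_singleton x)]
  rw [Finset.sum_eq_single x]
  · simp [ENNReal.toReal_ofReal (hv x)]
  · intro y _ hy
    simp [hy]
  · simp

lemma isProbabilityMeasure_toMeasure {v : State S d → ℝ} (hv : v ∈ stdSimplex ℝ (State S d)) :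
    IsProbabilityMeasure (toMeasure v) := by
  refine ⟨?_⟩
  rw [toMeasure, Measure.finsetSum_apply]
  simp only [Measure.smul_apply, smul_eq_mul, measure_univ, mul_one]
  rw [← ENNReal.ofReal_sum_of_nonneg fun x _ => hv.1 x, hv.2, ENNReal.ofReal_one]

end ToMeasure

/-! ### Rates of the backward process -/

section Rates

variable {S d : ℕ}

/-- The rates `μ` are nonnegative, bounded by `B`, and `B`-Lipschitz in time on `[0, L]`. -/
def IsLipschitzRate (B L : ℝ) (μ : ℝ → Jump S d → State S d → ℝ) : Prop :=
  ∀ s ∈ Icc 0 L, ∀ ν y, 0 ≤ μ s ν y ∧ μ s ν y ≤ B ∧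
    ∀ s' ∈ Icc 0 L, |μ s' ν y - μ s ν y| ≤ B * |s' - s|

lemma RegularOn.abs_sub_le {m M L : ℝ} {f : ℝ → ℝ} (hf : RegularOn m M L f) {s s' : ℝ}
    (hs : s ∈ Icc 0 L) (hs' : s' ∈ Icc 0 L) : |f s' - f s| ≤ M * |s' - s| :=
  (convex_Icc 0 L).norm_image_sub_le_of_norm_derivWithin_le
    (hf.1.differentiableOn (by norm_num)) (fun x hx => (hf.2 x hx).2.2.1) hs hs'

/-- The jump `ν` from `y` is charged if the backward process performs it with positive probability
rate at some time. -/
def IsCharged (L T : ℝ) (p : ℝ → State S d → ℝ) (μ : ℝ → Jump S d → State S d → ℝ)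
    (ν : Jump S d) (y : State S d) : Prop :=
  ∃ s ∈ Icc 0 L, 0 < μ s ν y * p (T - s) y

/-- A jump that is not charged has rate zero at all times, and so it has under the estimate, which
contains the factor `Q`. -/
lemma intensity_eq_zero_of_not_isCharged [NeZero S] {T δ : ℝ}
    {Q : ℝ → Matrix (State S d) (State S d) ℝ} {p : ℝ → State S d → ℝ}
    (hQ : ∀ t ∈ Icc δ T, IsRateMatrix (Q t)) (hp : ∀ t ∈ Icc δ T, ∀ x, 0 < p t x)
    {ν : Jump S d} {y : State S d} (h : ¬ IsCharged (T - δ) T p (intensity T Q (score p)) ν y)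
    {s : ℝ} (hs : s ∈ Icc 0 (T - δ)) (sc : ℝ → State S d → State S d → ℝ) :
    intensity T Q sc s ν y = 0 := by
  have ht : T - s ∈ Icc δ T := ⟨by linarith [hs.2], by linarith [hs.1]⟩
  have hne : y ≠ y + ν := fun h => ν.2 (by simpa using h.symm)
  have h0 : 0 ≤ Q (T - s) y (y + ν) := (hQ _ ht).2 _ _ hne
  have h1 : ¬ 0 < intensity T Q (score p) s ν y * p (T - s) y := fun h' => h ⟨s, hs, h'⟩
  have h2 : Q (T - s) y (y + ν) = 0 := by
    by_contra hQ0
    have hQpos := lt_of_le_of_ne h0 (Ne.symm hQ0)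
    exact h1 (mul_pos (mul_pos (div_pos (hp _ ht _) (hp _ ht _)) hQpos) (hp _ ht _))
  rw [intensity, h2, mul_zero]

lemma isLipschitzRate_of_dichotomy {m M L : ℝ} (hm : 0 < m)
    {μ : ℝ → Jump S d → State S d → ℝ}
    (h : ∀ ν y, RegularOn m M L (fun s => μ s ν y) ∨ ∀ s ∈ Icc 0 L, μ s ν y = 0) :
    IsLipschitzRate (|M| + 1) L μ := by
  intro s hs ν y
  have hM : M ≤ |M| + 1 := (le_abs_self M).trans (by linarith)
  rcases h ν y with h | h
  · refine ⟨hm.le.trans (h.2 s hs).1, (h.2 s hs).2.1.trans hM, fun s' hs' => ?_⟩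
    exact (h.abs_sub_le hs hs').trans (mul_le_mul_of_nonneg_right hM (abs_nonneg _))
  · refine ⟨(h s hs).ge, (h s hs).trans_le (by positivity), fun s' hs' => ?_⟩
    rw [h s hs, h s' hs', sub_zero, abs_zero]
    positivity

lemma IsRateMatrix.sum_col [NeZero S] {A : Matrix (State S d) (State S d) ℝ}
    (hA : IsRateMatrix A) (x : State S d) : ∑ y, A y x = 0 := by
  rw [← Finset.add_sum_erase _ _ (Finset.mem_univ x), hA.1 x]
  ring

/-- A positive unique stationary distribution makes the chain irreducible: if no mass left `B`, then
by stationarity none would enter it either, and the restriction of `π` to `B` would be stationary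
as well. -/
lemma exists_pos_rate_of_isUniqueStationary [NeZero S]
    {A : Matrix (State S d) (State S d) ℝ} (hA : IsRateMatrix A) {π : State S d → ℝ}
    (hπ : π ∈ stdSimplex ℝ (State S d)) (hpos : ∀ x, 0 < π x) (hst : IsUniqueStationary A π)
    (B : Finset (State S d)) (hB : B.Nonempty) (hBu : B ≠ Finset.univ) :
    ∃ y, y ∉ B ∧ ∃ x ∈ B, 0 < A y x := by
  classical
  by_contra! hno
  have hout : ∀ y, y ∉ B → ∀ x ∈ B, A y x = 0 := fun y hy x hx =>
    le_antisymm (hno y hy x hx) (hA.2 y x fun h => hy (h ▸ hx))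
  have hAπ : A *ᵥ π = 0 := (hst π hπ).2 rfl
  have hflux : ∑ y, (∑ x ∈ B, A x y) * π y = 0 := by
    simp_rw [Finset.sum_mul]
    rw [Finset.sum_comm]
    exact Finset.sum_eq_zero fun x _ => congrFun hAπ x
  have hcol : ∀ y ∈ B, ∑ x ∈ B, A x y = 0 := by
    intro y hy
    rw [← hA.sum_col y]
    exact Finset.sum_subset (Finset.subset_univ B) fun x _ hx => hout x hx y hy
  have hnn : ∀ y, y ∉ B → ∀ x ∈ B, 0 ≤ A x y := fun y hy x hx =>
    hA.2 x y fun h => hy (h ▸ hx)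
  have hterm : ∀ y ∈ Finset.univ, 0 ≤ (∑ x ∈ B, A x y) * π y := by
    intro y _
    by_cases hy : y ∈ B
    · rw [hcol y hy, zero_mul]
    · exact mul_nonneg (Finset.sum_nonneg (hnn y hy)) (hpos y).le
  have hin : ∀ y, y ∉ B → ∀ x ∈ B, A x y = 0 := by
    intro y hy x hx
    have h1 := (Finset.sum_eq_zero_iff_of_nonneg hterm).1 hflux y (Finset.mem_univ y)
    exact (Finset.sum_eq_zero_iff_of_nonneg (hnn y hy)).1
      ((mul_eq_zero.1 h1).resolve_right (hpos y).ne') x hx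
  set b := ∑ x ∈ B, π x with hb
  have hb0 : 0 < b := Finset.sum_pos (fun x _ => hpos x) hB
  set v : State S d → ℝ := fun x => if x ∈ B then π x / b else 0 with hv
  have hvS : v ∈ stdSimplex ℝ (State S d) := by
    refine ⟨fun x => ?_, ?_⟩
    · simp only [hv]
      split_ifs
      · exact div_nonneg (hpos x).le hb0.le
      · exact le_rfl
    · simp only [hv]
      rw [Finset.sum_ite_mem, Finset.univ_inter, ← Finset.sum_div, ← hb, div_self hb0.ne']
  have hvA : A *ᵥ v = 0 := by
    ext x
    have h1 : (A *ᵥ v) x = ∑ y ∈ B, A x y * (π y / b) := by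
      simp only [Matrix.mulVec, dotProduct, hv, mul_ite, mul_zero]
      rw [Finset.sum_ite_mem, Finset.univ_inter]
    rw [h1]
    by_cases hx : x ∈ B
    · have h2 : ∑ y ∈ B, A x y * π y = 0 := by
        refine Eq.trans ?_ (congrFun hAπ x)
        exact Finset.sum_subset (Finset.subset_univ B) fun y _ hy => by
          rw [hin y hy x hx, zero_mul]
      simp_rw [← mul_div_assoc]
      rw [← Finset.sum_div, h2, zero_div]
      rfl
    · exact Finset.sum_eq_zero fun y hy => by rw [hout x hx y hy, zero_mul]
  obtain ⟨z, hz⟩ : ∃ z, z ∉ B := by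
    by_contra! h
    exact hBu (Finset.eq_univ_iff_forall.2 h)
  have h3 := congrFun ((hst v hvS).1 hvA) z
  simp only [hv, if_neg hz] at h3
  exact (hpos z).ne h3

end Rates

/-! ### The backward equation to first order in time -/

section Drift

variable {S d : ℕ}

lemma extendZero_mul_left (c : ℝ) (a : Jump S d → ℝ) (z : State S d) :
    extendZero (fun ν => c * a ν) z = c * extendZero a z := by
  unfold extendZero
  split_ifs <;> simp

lemma abs_extendZero_le {a : Jump S d → ℝ} {B : ℝ} (hB : 0 ≤ B) (ha : ∀ ν, |a ν| ≤ B)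
    (z : State S d) : |extendZero a z| ≤ B := by
  unfold extendZero
  split_ifs with h
  · exact ha _
  · simpa using hB

variable [NeZero S]

/-- The right-hand side of the master equation with jump rates `a`, at the mass vector `q`: what
flows into `x` minus what flows out of `x`. -/
noncomputable def drift (a : Jump S d → State S d → ℝ) (q : State S d → ℝ) (x : State S d) : ℝ :=
  ∑ y, q y * extendZero (fun ν => a ν y) (x - y) - q x * ∑ ν, a ν x

lemma push_firstOrder (Δ : ℝ) (a : Jump S d → State S d → ℝ) (q : State S d → ℝ)
    (x : State S d) :
    push (fun y => firstOrder (fun ν => Δ * a ν y) y) q x = q x + Δ * drift a q x := by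
  classical
  unfold push firstOrder drift
  simp_rw [extendZero_mul_left, mul_add, mul_ite, mul_zero]
  have h1 : ∑ y, q y * (Δ * extendZero (fun ν => a ν y) (x - y)) =
      Δ * ∑ y, q y * extendZero (fun ν => a ν y) (x - y) := by
    rw [Finset.mul_sum]
    exact Finset.sum_congr rfl fun y _ => mul_left_comm _ _ _
  rw [Finset.sum_add_distrib, Finset.sum_ite_eq Finset.univ x, if_pos (Finset.mem_univ x), h1,
    ← Finset.mul_sum]
  ring

lemma abs_extendZero_sub_le (a b : Jump S d → ℝ) (z : State S d) :
    |extendZero a z - extendZero b z| ≤ ∑ ν, |a ν - b ν| := by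
  have h0 : 0 ≤ ∑ ν, |a ν - b ν| := Finset.sum_nonneg fun ν _ => abs_nonneg _
  unfold extendZero
  split_ifs with h
  · exact Finset.single_le_sum (f := fun ν => |a ν - b ν|) (fun ν _ => abs_nonneg _)
      (Finset.mem_univ _)
  · simpa using h0

lemma abs_drift_sub_le (a b : Jump S d → State S d → ℝ) {q : State S d → ℝ} (hq : ∀ x, 0 ≤ q x)
    (x : State S d) :
    |drift a q x - drift b q x| ≤ 2 * ∑ y, q y * ∑ ν, |a ν y - b ν y| := by
  have h1 : drift a q x - drift b q x =
      ∑ y, q y * (extendZero (fun ν => a ν y) (x - y) - extendZero (fun ν => b ν y) (x - y)) -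
        q x * ∑ ν, (a ν x - b ν x) := by
    unfold drift
    simp_rw [mul_sub, Finset.sum_sub_distrib]
    ring
  have h2 : |∑ y, q y * (extendZero (fun ν => a ν y) (x - y) -
      extendZero (fun ν => b ν y) (x - y))| ≤ ∑ y, q y * ∑ ν, |a ν y - b ν y| := by
    refine (Finset.abs_sum_le_sum_abs _ _).trans (Finset.sum_le_sum fun y _ => ?_)
    rw [abs_mul, abs_of_nonneg (hq y)]
    exact mul_le_mul_of_nonneg_left (abs_extendZero_sub_le _ _ _) (hq y)
  have h3 : |q x * ∑ ν, (a ν x - b ν x)| ≤ ∑ y, q y * ∑ ν, |a ν y - b ν y| := by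
    rw [abs_mul, abs_of_nonneg (hq x)]
    refine (mul_le_mul_of_nonneg_left (Finset.abs_sum_le_sum_abs _ _) (hq x)).trans ?_
    exact Finset.single_le_sum (f := fun y => q y * ∑ ν, |a ν y - b ν y|)
      (fun y _ => mul_nonneg (hq y) (Finset.sum_nonneg fun ν _ => abs_nonneg _))
      (Finset.mem_univ x)
  rw [h1]
  linarith [abs_sub (∑ y, q y * (extendZero (fun ν => a ν y) (x - y) -
      extendZero (fun ν => b ν y) (x - y))) (q x * ∑ ν, (a ν x - b ν x))]

/-- The drift is Lipschitz in the mass vector, for the maximum norm. -/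
lemma abs_drift_sub_drift_le {a : Jump S d → State S d → ℝ} {B : ℝ} (hB : 0 ≤ B)
    (ha : ∀ ν y, |a ν y| ≤ B) {q q' : State S d → ℝ} {η : ℝ} (h : ∀ x, |q' x - q x| ≤ η)
    (x : State S d) :
    |drift a q' x - drift a q x| ≤
      (Fintype.card (State S d) + Fintype.card (Jump S d)) * B * η := by
  have hη : 0 ≤ η := (abs_nonneg _).trans (h x)
  have h1 : drift a q' x - drift a q x =
      ∑ y, (q' y - q y) * extendZero (fun ν => a ν y) (x - y) - (q' x - q x) * ∑ ν, a ν x := by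
    unfold drift
    simp_rw [sub_mul, Finset.sum_sub_distrib]
    ring
  have h2 : |∑ y, (q' y - q y) * extendZero (fun ν => a ν y) (x - y)| ≤
      Fintype.card (State S d) * (η * B) := by
    calc _ ≤ ∑ _y : State S d, η * B := by
          refine (Finset.abs_sum_le_sum_abs _ _).trans (Finset.sum_le_sum fun y _ => ?_)
          rw [abs_mul]
          exact mul_le_mul (h y) (abs_extendZero_le hB (fun ν => ha ν y) _) (abs_nonneg _) hη
      _ = _ := by rw [Finset.sum_const, Finset.card_univ, nsmul_eq_mul]
  have h3 : |(q' x - q x) * ∑ ν, a ν x| ≤ η * (Fintype.card (Jump S d) * B) := by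
    rw [abs_mul]
    refine mul_le_mul (h x) ?_ (abs_nonneg _) hη
    calc _ ≤ ∑ _ν : Jump S d, B :=
          (Finset.abs_sum_le_sum_abs _ _).trans (Finset.sum_le_sum fun ν _ => ha ν x)
      _ = _ := by rw [Finset.sum_const, Finset.card_univ, nsmul_eq_mul]
  rw [h1]
  linarith [abs_sub (∑ y, (q' y - q y) * extendZero (fun ν => a ν y) (x - y))
    ((q' x - q x) * ∑ ν, a ν x)]

/-- The backward marginals solve the master equation with the rates given by the true score. -/
lemma hasDerivWithinAt_backward {T δ : ℝ} (hδ : 0 ≤ δ)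
    {Q : ℝ → Matrix (State S d) (State S d) ℝ} {p : ℝ → State S d → ℝ}
    (hfwd : IsForwardProcess T Q p) (hp : ∀ t ∈ Icc δ T, ∀ x, 0 < p t x) {s : ℝ}
    (hs : s ∈ Icc 0 (T - δ)) (x : State S d) :
    HasDerivWithinAt (fun s => p (T - s) x)
      (drift (intensity T Q (score p) s) (p (T - s)) x) (Icc 0 (T - δ)) s := by
  classical
  have ht : T - s ∈ Icc δ T := ⟨by linarith [hs.2], by linarith [hs.1]⟩
  have ht0 : T - s ∈ Icc 0 T := ⟨hδ.trans ht.1, ht.2⟩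
  have h1 : HasDerivWithinAt (fun t => p t x) ((Q (T - s) *ᵥ p (T - s)) x) (Icc 0 T) (T - s) :=
    hasDerivWithinAt_pi.1 (hfwd.2.2 _ ht0) x
  have h2 : HasDerivWithinAt (fun s : ℝ => T - s) (-1) (Icc 0 (T - δ)) s :=
    (hasDerivAt_id s).const_sub T |>.hasDerivWithinAt
  have h3 := HasDerivWithinAt.comp s h1 h2 fun u hu =>
    (⟨by linarith [hu.2], by linarith [hu.1]⟩ : T - u ∈ Icc 0 T)
  refine h3.congr_deriv ?_
  have hR : ∀ y z, p (T - s) y *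
      extendZero (fun ν => intensity T Q (score p) s ν y) (z - y) =
        if z = y then 0 else p (T - s) z * Q (T - s) y z := by
    intro y z
    by_cases hzy : z = y
    · rw [if_pos hzy, hzy, sub_self, extendZero_zero, mul_zero]
    · have hne : z - y ≠ 0 := sub_ne_zero.2 hzy
      have := (hp _ ht y).ne'
      rw [if_neg hzy, extendZero, dif_pos hne]
      simp only [intensity, score, add_sub_cancel]
      field_simp
  unfold drift
  rw [← sum_extendZero_sub (fun ν => intensity T Q (score p) s ν x) x, Finset.mul_sum]
  simp_rw [hR]
  have h4 : ∀ y, (if x = y then 0 else p (T - s) x * Q (T - s) y x) =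
      p (T - s) x * Q (T - s) y x - if x = y then p (T - s) x * Q (T - s) x x else 0 := by
    intro y
    split_ifs with h
    · rw [h, sub_self]
    · rw [sub_zero]
  have h5 : ∀ z, (if z = x then 0 else p (T - s) z * Q (T - s) x z) =
      Q (T - s) x z * p (T - s) z - if x = z then p (T - s) x * Q (T - s) x x else 0 := by
    intro z
    by_cases h : z = x
    · rw [if_pos h, if_pos h.symm, h]
      ring
    · rw [if_neg h, if_neg (Ne.symm h)]
      ring
  simp_rw [h4, h5]
  rw [Finset.sum_sub_distrib, Finset.sum_sub_distrib, ← Finset.mul_sum,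
    (hfwd.1 _ ht0).sum_col, mul_zero]
  simp only [Matrix.mulVec, dotProduct]
  ring

/-- First-order Taylor expansion of a solution of the master equation, with an error that depends
only on the number of states and on the bound `B` for the rates and their time derivatives. -/
lemma abs_sub_sub_drift_le {L B : ℝ} (hB : 0 ≤ B) {μ : ℝ → Jump S d → State S d → ℝ}
    (hμ : IsLipschitzRate B L μ) {q : ℝ → State S d → ℝ}
    (hq : ∀ s ∈ Icc 0 L, q s ∈ stdSimplex ℝ (State S d))
    (hder : ∀ s ∈ Icc 0 L, ∀ x,
      HasDerivWithinAt (fun s => q s x) (drift (μ s) (q s) x) (Icc 0 L) s)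
    {s s' : ℝ} (hs : s ∈ Icc 0 L) (hs' : s' ∈ Icc 0 L) (hss' : s ≤ s') (x : State S d) :
    |q s' x - q s x - (s' - s) * drift (μ s) (q s) x| ≤
      2 * Fintype.card (Jump S d) * B *
        ((Fintype.card (State S d) + Fintype.card (Jump S d)) * B + 1) * (s' - s) ^ 2 := by
  set K : ℝ := (Fintype.card (Jump S d) : ℝ) with hK
  set n : ℝ := (Fintype.card (State S d) : ℝ) with hn
  have hK0 : 0 ≤ K := by positivity
  have hn0 : 0 ≤ n := by positivity
  have habs : ∀ u ∈ Icc 0 L, ∀ ν y, |μ u ν y| ≤ B := fun u hu ν y => by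
    rw [abs_of_nonneg (hμ u hu ν y).1]
    exact (hμ u hu ν y).2.1
  have havg : ∀ u ∈ Icc 0 L, ∀ f : Jump S d → State S d → ℝ, ∀ c, (∀ ν y, |f ν y| ≤ c) →
      ∑ y, q u y * ∑ ν, |f ν y| ≤ K * c := by
    intro u hu f c hf
    calc ∑ y, q u y * ∑ ν, |f ν y| ≤ ∑ y, q u y * (K * c) := by
          refine Finset.sum_le_sum fun y _ => mul_le_mul_of_nonneg_left ?_ ((hq u hu).1 y)
          calc ∑ ν, |f ν y| ≤ ∑ _ν : Jump S d, c := Finset.sum_le_sum fun ν _ => hf ν y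
            _ = _ := by rw [Finset.sum_const, Finset.card_univ, nsmul_eq_mul]
      _ = K * c := by rw [← Finset.sum_mul, (hq u hu).2, one_mul]
  have hdrift : ∀ u ∈ Icc 0 L, ∀ z, |drift (μ u) (q u) z| ≤ 2 * (K * B) := by
    intro u hu z
    have h1 := abs_drift_sub_le (μ u) 0 (hq u hu).1 z
    have h2 : drift (0 : Jump S d → State S d → ℝ) (q u) z = 0 := by
      simp [drift, extendZero]
    rw [h2, sub_zero] at h1
    refine h1.trans (mul_le_mul_of_nonneg_left ?_ zero_le_two)
    exact havg u hu (fun ν y => μ u ν y - 0) B fun ν y => by simpa using habs u hu ν y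
  have hlip : ∀ u ∈ Icc 0 L, ∀ z, |q u z - q s z| ≤ 2 * (K * B) * |u - s| := fun u hu z =>
    (convex_Icc 0 L).norm_image_sub_le_of_norm_hasDerivWithin_le
      (fun v hv => hder v hv z) (fun v hv => hdrift v hv z) hs hu
  have hsub : Icc s s' ⊆ Icc 0 L := Icc_subset_Icc hs.1 hs'.2
  have hdd : ∀ u ∈ Icc s s', |drift (μ u) (q u) x - drift (μ s) (q s) x| ≤
      2 * K * B * ((n + K) * B + 1) * (s' - s) := by
    intro u hu
    have hus : |u - s| ≤ s' - s := by
      rw [abs_of_nonneg (by linarith [hu.1])]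
      linarith [hu.2]
    have h1 := abs_drift_sub_le (μ u) (μ s) (hq u (hsub hu)).1 x
    have h2 := havg u (hsub hu) (fun ν y => μ u ν y - μ s ν y) (B * (s' - s)) fun ν y =>
      ((hμ s hs ν y).2.2 u (hsub hu)).trans (mul_le_mul_of_nonneg_left hus hB)
    have h3 := abs_drift_sub_drift_le hB (habs s hs)
      (fun z => (hlip u (hsub hu) z).trans (mul_le_mul_of_nonneg_left hus (by positivity))) x
    have h4 := _root_.abs_sub_le (drift (μ u) (q u) x) (drift (μ s) (q u) x)
      (drift (μ s) (q s) x)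
    rw [← hK, ← hn] at h3
    linarith
  have hder' : ∀ u ∈ Icc s s', HasDerivWithinAt
      (fun u => q u x - u * drift (μ s) (q s) x)
      (drift (μ u) (q u) x - 1 * drift (μ s) (q s) x) (Icc s s') u := fun u hu =>
    ((hder u (hsub hu) x).mono hsub).sub
      ((hasDerivWithinAt_id u _).mul_const _)
  have hfin := (convex_Icc s s').norm_image_sub_le_of_norm_hasDerivWithin_le hder'
    (fun u hu => by rw [one_mul]; exact hdd u hu) (left_mem_Icc.2 hss') (right_mem_Icc.2 hss')
  rw [Real.norm_eq_abs, Real.norm_eq_abs, abs_of_nonneg (sub_nonneg.2 hss')] at hfin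
  calc |q s' x - q s x - (s' - s) * drift (μ s) (q s) x|
      = |q s' x - s' * drift (μ s) (q s) x - (q s x - s * drift (μ s) (q s) x)| := by
        congr 1
        ring
    _ ≤ _ := hfin.trans_eq (by ring)

end Drift

/-! ### The sampler as a perturbed Markov chain -/

section Sampler

variable {S d : ℕ}

/-- What the error analysis uses of the second-stage intensities: they are at most `Λ`, and at
`y* = y` their positive parts agree with the estimated intensities at `s_n` up to `B Δ_n`. -/
def IsSecondStage (Λ B : ℝ) (N : ℕ) (s : ℕ → ℝ) (μh : ℝ → Jump S d → State S d → ℝ)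
    (rate : ℕ → State S d → State S d → Jump S d → ℝ) : Prop :=
  ∀ n < N, ∀ y, (∀ z ν, rate n y z ν ≤ Λ) ∧
    ∀ ν, |max (rate n y y ν) 0 - μh (s n) ν y| ≤ B * (s (n + 1) - s n)

lemma IsGrid.mem_Icc {L : ℝ} {N : ℕ} {s : ℕ → ℝ} (h : IsGrid L N s) {n : ℕ} (hn : n ≤ N) :
    s n ∈ Icc 0 L := by
  have hmono : ∀ i j, i ≤ j → j ≤ N → s i ≤ s j := by
    intro i j hij
    induction j, hij using Nat.le_induction with
    | base => exact fun _ => le_rfl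
    | succ j _ ih => exact fun hj => (ih (by omega)).trans (h.2.2 j hj).le
  exact ⟨h.1 ▸ hmono 0 n (Nat.zero_le _) hn, h.2.1 ▸ hmono n N hn le_rfl⟩

lemma IsGrid.sectionPoint_mem_Icc {L θ : ℝ} {N : ℕ} {s : ℕ → ℝ} (h : IsGrid L N s)
    (hθ : θ ∈ Ioc (0 : ℝ) (1 / 2)) {n : ℕ} (hn : n < N) : sectionPoint θ s n ∈ Icc 0 L :=
  convex_Icc 0 L (h.mem_Icc hn.le) (h.mem_Icc hn) (by linarith [hθ.2]) hθ.1.le (by ring)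

/-- The weight of the first-stage intensity is nonpositive as `θ ≤ 1/2`, so that only the other
summand matters for the upper bound; on the diagonal, the weights `1/(2θ)` and the step `θ Δ_n`
between `s_n` and `ρ_n` compensate. -/
lemma isSecondStage_combinedIntensity {θ B L : ℝ} (hθ : θ ∈ Ioc (0 : ℝ) (1 / 2)) (hB : 0 ≤ B)
    {μh : ℝ → Jump S d → State S d → ℝ} (hμh : IsLipschitzRate B L μh) {N : ℕ} {s : ℕ → ℝ}
    (hs : IsGrid L N s) : IsSecondStage (B / θ) B N s μh (combinedIntensity μh θ s) := by
  intro n hn y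
  have hθ0 := hθ.1
  have hsn := hs.mem_Icc hn.le
  have hρ := hs.sectionPoint_mem_Icc hθ hn
  have hΔ : 0 < s (n + 1) - s n := sub_pos.2 (hs.2.2 n hn)
  refine ⟨fun z ν => ?_, fun ν => ?_⟩
  · have h1 : (1 - 1 / (2 * θ)) * μh (s n) ν y ≤ 0 := by
      refine mul_nonpos_of_nonpos_of_nonneg ?_ (hμh _ hsn ν y).1
      rw [sub_nonpos, le_div_iff₀ (by positivity)]
      linarith [hθ.2]
    have h2 : 1 / (2 * θ) * μh (sectionPoint θ s n) ν z ≤ 1 / (2 * θ) * B :=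
      mul_le_mul_of_nonneg_left (hμh _ hρ ν z).2.1 (by positivity)
    have h3 : 1 / (2 * θ) * B = B / θ / 2 := by field_simp
    have h4 : 0 ≤ B / θ := by positivity
    unfold combinedIntensity
    linarith
  · have h0 := (hμh _ hsn ν y).1
    have h1 : combinedIntensity μh θ s n y y ν - μh (s n) ν y =
        1 / (2 * θ) * (μh (sectionPoint θ s n) ν y - μh (s n) ν y) := by
      unfold combinedIntensity
      ring
    have h2 : |combinedIntensity μh θ s n y y ν - μh (s n) ν y| ≤ B * (s (n + 1) - s n) := by
      rw [h1, abs_mul, abs_of_nonneg (by positivity : 0 ≤ 1 / (2 * θ))]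
      have h3 := (hμh _ hsn ν y).2.2 _ hρ
      have h4 : sectionPoint θ s n - s n = θ * (s (n + 1) - s n) := by
        unfold sectionPoint
        ring
      rw [h4, abs_of_nonneg (by positivity : 0 ≤ θ * (s (n + 1) - s n))] at h3
      calc _ ≤ 1 / (2 * θ) * (B * (θ * (s (n + 1) - s n))) := by gcongr
        _ = B * (s (n + 1) - s n) / 2 := by field_simp
        _ ≤ _ := by linarith [mul_nonneg hB hΔ.le]
    calc |max (combinedIntensity μh θ s n y y ν) 0 - μh (s n) ν y|
        = |max (combinedIntensity μh θ s n y y ν) 0 - max (μh (s n) ν y) 0| := by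
          rw [max_eq_left h0]
      _ ≤ _ := (abs_max_sub_max_le_abs _ _ _).trans h2

lemma isSecondStage_algorithmIntensity {θ B L : ℝ} (hθ : θ ∈ Ioc (0 : ℝ) (1 / 2)) (hB : 0 ≤ B)
    {μh : ℝ → Jump S d → State S d → ℝ} (hμh : IsLipschitzRate B L μh) {N : ℕ} {s : ℕ → ℝ}
    (hs : IsGrid L N s) : IsSecondStage (B / θ) B N s μh (algorithmIntensity μh θ s) := by
  intro n hn y
  have h := isSecondStage_combinedIntensity hθ hB hμh hs n hn y
  have h0 : 0 ≤ B / θ := div_nonneg hB hθ.1.le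
  refine ⟨fun z ν => ?_, fun ν => ?_⟩
  · unfold algorithmIntensity
    split_ifs
    · exact max_le h0 (h.1 z ν)
    · exact h0
  · unfold algorithmIntensity
    split_ifs with hpos
    · rw [max_comm 0, max_eq_left (le_max_right _ _)]
      exact h.2 ν
    · have h1 : μh (s n) ν y = 0 :=
        le_antisymm (not_lt.1 hpos) (hμh _ (hs.mem_Icc hn.le) ν y).1
      rw [h1, max_self, sub_zero, abs_zero]
      exact mul_nonneg hB (sub_nonneg.2 (hs.2.2 n hn).le)

variable [NeZero S]

/-- The transition matrix of the `n`-th step of a two-stage scheme. -/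
noncomputable def stepMatrix (μh : ℝ → Jump S d → State S d → ℝ) (θ : ℝ) (s : ℕ → ℝ)
    (rate : ℕ → State S d → State S d → Jump S d → ℝ) (n : ℕ) (y x : State S d) : ℝ :=
  (twoStage y (fun ν => μh (s n) ν y * (θ * (s (n + 1) - s n)))
    fun z ν => rate n y z ν * (s (n + 1) - s n)).real {x}

lemma isStochastic_stepMatrix (μh : ℝ → Jump S d → State S d → ℝ) (θ : ℝ) (s : ℕ → ℝ)
    (rate : ℕ → State S d → State S d → Jump S d → ℝ) (n : ℕ) :
    IsStochastic (stepMatrix μh θ s rate n) :=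
  ⟨fun _ _ => measureReal_nonneg, fun _ => sum_measureReal_singleton_eq_one _⟩

lemma isProbabilityMeasure_twoStageLaw (μh : ℝ → Jump S d → State S d → ℝ) (θ : ℝ) (s : ℕ → ℝ)
    (rate : ℕ → State S d → State S d → Jump S d → ℝ) (q₀ : Measure (State S d))
    [IsProbabilityMeasure q₀] (n : ℕ) :
    IsProbabilityMeasure (twoStageLaw μh θ s rate q₀ n) := by
  induction n with
  | zero => assumption
  | succ n ih =>
    exact isProbabilityMeasure_bind_of_finite _ fun y =>
      twoStage y (fun ν => μh (s n) ν y * (θ * (s (n + 1) - s n)))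
        fun z ν => rate n y z ν * (s (n + 1) - s n)

lemma twoStageLaw_succ_real (μh : ℝ → Jump S d → State S d → ℝ) (θ : ℝ) (s : ℕ → ℝ)
    (rate : ℕ → State S d → State S d → Jump S d → ℝ) (q₀ : Measure (State S d))
    [IsProbabilityMeasure q₀] (n : ℕ) (x : State S d) :
    (twoStageLaw μh θ s rate q₀ (n + 1)).real {x} =
      push (stepMatrix μh θ s rate n) (fun y => (twoStageLaw μh θ s rate q₀ n).real {y}) x := by
  have := isProbabilityMeasure_twoStageLaw μh θ s rate q₀ n
  exact bind_real_singleton (twoStageLaw μh θ s rate q₀ n) (fun y =>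
      twoStage y (fun ν => μh (s n) ν y * (θ * (s (n + 1) - s n)))
        fun z ν => rate n y z ν * (s (n + 1) - s n)) x

/-- The constant in the quadratic error of the first-order expansion of `stepMatrix`. -/
noncomputable def stepConst (S d : ℕ) [NeZero S] (B Λ : ℝ) : ℝ :=
  Fintype.card (State S d) * ((Fintype.card (Jump S d) + 1) * B +
    (Fintype.card (Jump S d) ^ 2 + 2 * Fintype.card (Jump S d)) * Λ ^ 2)

section Step

variable {μh : ℝ → Jump S d → State S d → ℝ} {θ B Λ L : ℝ} {N : ℕ} {s : ℕ → ℝ}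
  {rate : ℕ → State S d → State S d → Jump S d → ℝ}

lemma exp_neg_le_stepMatrix_self (hΛ : 0 ≤ Λ) (hs : IsGrid L N s)
    (hrate : IsSecondStage Λ B N s μh rate) {n : ℕ} (hn : n < N) (y : State S d) :
    Real.exp (-(Fintype.card (Jump S d) * Λ * (s (n + 1) - s n))) ≤
      stepMatrix μh θ s rate n y y := by
  have hΔ : 0 ≤ s (n + 1) - s n := sub_nonneg.2 (hs.2.2 n hn).le
  rw [mul_assoc]
  exact exp_neg_le_twoStage_self y _ (mul_nonneg hΛ hΔ) fun z ν =>
    mul_le_mul_of_nonneg_right ((hrate n hn y).1 z ν) hΔ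

lemma abs_stepMatrix_sub_firstOrder_le (hθ : θ ∈ Ioc (0 : ℝ) (1 / 2)) (hB : 0 ≤ B) (hBΛ : B ≤ Λ)
    (hμh : IsLipschitzRate B L μh) (hs : IsGrid L N s)
    (hrate : IsSecondStage Λ B N s μh rate) {n : ℕ} (hn : n < N) (y x : State S d) :
    |stepMatrix μh θ s rate n y x -
        firstOrder (fun ν => (s (n + 1) - s n) * μh (s n) ν y) y x| ≤
      stepConst S d B Λ * (s (n + 1) - s n) ^ 2 := by
  have hΔ : 0 ≤ s (n + 1) - s n := sub_nonneg.2 (hs.2.2 n hn).le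
  set Δ := s (n + 1) - s n with hΔdef
  have hsn := hs.mem_Icc hn.le
  have h := firstOrder_sub_le_twoStage (y := y) (α := fun ν => μh (s n) ν y * (θ * Δ))
    (b := fun z ν => rate n y z ν * Δ) (g := fun ν => Δ * μh (s n) ν y) (B := Λ * Δ)
    (σ := B * Δ * Δ) (mul_nonneg (hB.trans hBΛ) hΔ) ?_ ?_ ?_ (by positivity)
  · refine (abs_twoStage_sub_firstOrder_le h x).trans_eq ?_
    unfold stepConst
    ring
  · intro ν
    calc μh (s n) ν y * (θ * Δ) ≤ Λ * (1 * Δ) :=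
          mul_le_mul ((hμh _ hsn ν y).2.1.trans hBΛ)
            (mul_le_mul_of_nonneg_right (by linarith [hθ.2]) hΔ)
            (mul_nonneg hθ.1.le hΔ) (hB.trans hBΛ)
      _ = Λ * Δ := by ring
  · exact fun z ν => mul_le_mul_of_nonneg_right ((hrate n hn y).1 z ν) hΔ
  · intro ν
    have h1 : max (rate n y y ν * Δ) 0 - Δ * μh (s n) ν y =
        (max (rate n y y ν) 0 - μh (s n) ν y) * Δ := by
      rw [← zero_mul Δ, ← max_mul_of_nonneg _ _ hΔ, zero_mul]
      ring
    rw [h1, abs_mul, abs_of_nonneg hΔ]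
    exact mul_le_mul_of_nonneg_right ((hrate n hn y).2 ν) hΔ

/-- However large the steps are, the sampler stays put with a probability that decays at most
exponentially in time. -/
lemma exp_neg_le_twoStageLaw (hΛ : 0 ≤ Λ) (hs : IsGrid L N s)
    (hrate : IsSecondStage Λ B N s μh rate) {q₀ : Measure (State S d)} [IsProbabilityMeasure q₀]
    {c₀ : ℝ} (hc₀ : ∀ x, c₀ ≤ q₀.real {x}) (x : State S d) :
    ∀ n ≤ N, c₀ * Real.exp (-(Fintype.card (Jump S d) * Λ * s n)) ≤
      (twoStageLaw μh θ s rate q₀ n).real {x} := by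
  intro n
  induction n with
  | zero =>
    intro _
    rw [hs.1, mul_zero, neg_zero, Real.exp_zero, mul_one]
    exact hc₀ x
  | succ n ih =>
    intro hn
    rw [twoStageLaw_succ_real]
    refine le_trans ?_ (Finset.single_le_sum (f := fun y =>
      (twoStageLaw μh θ s rate q₀ n).real {y} * stepMatrix μh θ s rate n y x)
      (fun y _ => mul_nonneg measureReal_nonneg measureReal_nonneg) (Finset.mem_univ x))
    refine le_trans (le_of_eq ?_) (mul_le_mul (ih (by omega))
      (exp_neg_le_stepMatrix_self hΛ hs hrate hn x) (Real.exp_pos _).le measureReal_nonneg)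
    rw [mul_assoc c₀, ← Real.exp_add]
    ring_nf

end Step

end Sampler

/-! ### Accumulation of the errors -/

/-- The χ²-divergence between a perturbed chain `q` and a chain `r` bounded below by `c₁`: thanks to
the contraction in each step, the squared relative errors add up linearly in time. -/
lemma chiSq_le_chiSq_add_sum {X : Type*} [Fintype X] {E : X → X → Prop} (hE : IsCutConnected E)
    {N : ℕ} {P : ℕ → X → X → ℝ} {q r : ℕ → X → ℝ} {Δ A : ℕ → ℝ} {a c₁ D : ℝ} (ha : 0 < a)
    (hc₁ : 0 < c₁) (hP : ∀ n < N, IsStochastic (P n))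
    (hr : ∀ n ≤ N, ∀ x, c₁ ≤ r n x) (hr1 : ∀ n ≤ N, ∑ x, r n x = 1)
    (hq1 : ∀ n ≤ N, ∑ x, q n x = 1) (hstep : ∀ n < N, ∀ x, r (n + 1) x = push (P n) (r n) x)
    (hΔ : ∀ n < N, 0 < Δ n) (hΔ1 : ∀ n < N, a * Δ n ≤ 1 / 2)
    (hstay : ∀ n < N, ∀ x, 1 / 2 ≤ P n x x)
    (hedge : ∀ n < N, ∀ y x, y ≠ x → E y x → a * Δ n ≤ P n y x)
    (hq : ∀ n < N, ∀ x, |q (n + 1) x - push (P n) (q n) x| ≤ D * (Δ n * (Δ n + A n))) :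
    ∀ k ≤ N, chiSq (q k - r k) (r k) ≤ chiSq (q 0 - r 0) (r 0) +
      4 * (Fintype.card X : ℝ) ^ 3 * D ^ 2 / (c₁ ^ 2 * a) *
        ∑ n ∈ Finset.range k, Δ n * (Δ n + A n) ^ 2 := by
  intro k
  induction k with
  | zero => simp
  | succ n ih =>
    intro hn
    have hnN : n < N := hn
    have hpush : push (P n) (r n) = r (n + 1) := funext fun x => (hstep n hnN x).symm
    have h := chiSq_step hE (hP n hnN) (e := q n - r n) (r := r n)
      (ζ := q (n + 1) - push (P n) (q n)) hc₁ (mul_pos ha (hΔ n hnN)) (hΔ1 n hnN)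
      (hr n hnN.le) (fun x => by rw [hpush]; exact hr (n + 1) hn x) (hr1 n hnN.le)
      (by simp [Finset.sum_sub_distrib, hr1 n hnN.le, hq1 n hnN.le]) (hstay n hnN) (hedge n hnN)
      (hq n hnN)
    have hsplit : push (P n) (q n - r n) + (q (n + 1) - push (P n) (q n)) =
        q (n + 1) - r (n + 1) := by
      ext x
      simp only [Pi.add_apply, Pi.sub_apply, hstep n hnN x, push, sub_mul, Finset.sum_sub_distrib]
      ring
    rw [hsplit, hpush] at h
    rw [Finset.sum_range_succ, mul_add]
    have h2 : 4 * (Fintype.card X : ℝ) ^ 3 / (c₁ ^ 2 * (a * Δ n)) *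
        (D * (Δ n * (Δ n + A n))) ^ 2 =
        4 * (Fintype.card X : ℝ) ^ 3 * D ^ 2 / (c₁ ^ 2 * a) * (Δ n * (Δ n + A n) ^ 2) := by
      have := (hΔ n hnN).ne'
      field_simp
    linarith [ih hnN.le]

section Assembly

variable {S d : ℕ} [NeZero S]

/-- One step of the backward process, compared with one step of the sampler started from the same
law. -/
lemma abs_sub_push_stepMatrix_le {μ μh : ℝ → Jump S d → State S d → ℝ} {θ B Λ L : ℝ} {N : ℕ}
    {s : ℕ → ℝ} {rate : ℕ → State S d → State S d → Jump S d → ℝ} {q : ℝ → State S d → ℝ}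
    (hθ : θ ∈ Ioc (0 : ℝ) (1 / 2)) (hB : 0 ≤ B) (hBΛ : B ≤ Λ) (hμ : IsLipschitzRate B L μ)
    (hμh : IsLipschitzRate B L μh) (hs : IsGrid L N s) (hrate : IsSecondStage Λ B N s μh rate)
    (hq : ∀ s ∈ Icc 0 L, q s ∈ stdSimplex ℝ (State S d))
    (hder : ∀ s ∈ Icc 0 L, ∀ x,
      HasDerivWithinAt (fun s => q s x) (drift (μ s) (q s) x) (Icc 0 L) s)
    {n : ℕ} (hn : n < N) (x : State S d) :
    |q (s (n + 1)) x - push (stepMatrix μh θ s rate n) (q (s n)) x| ≤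
      (2 * Fintype.card (Jump S d) * B *
        ((Fintype.card (State S d) + Fintype.card (Jump S d)) * B + 1) +
        stepConst S d B Λ + 2) * ((s (n + 1) - s n) * ((s (n + 1) - s n) +
        ∑ y, q (s n) y * ∑ ν, |μ (s n) ν y - μh (s n) ν y|)) := by
  have hsn := hs.mem_Icc hn.le
  have hsn' := hs.mem_Icc hn
  have hq0 := hq _ hsn
  have h1 := abs_sub_sub_drift_le hB hμ hq hder hsn hsn' (hs.2.2 n hn).le x
  have h2 := abs_drift_sub_le (μ (s n)) (μh (s n)) hq0.1 x
  set Δ := s (n + 1) - s n with hΔdef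
  have hΔ : 0 < Δ := sub_pos.2 (hs.2.2 n hn)
  set A := ∑ y, q (s n) y * ∑ ν, |μ (s n) ν y - μh (s n) ν y| with hA
  have hA0 : 0 ≤ A := Finset.sum_nonneg fun y _ => mul_nonneg (hq0.1 y)
    (Finset.sum_nonneg fun ν _ => abs_nonneg _)
  set C₂ := 2 * (Fintype.card (Jump S d) : ℝ) * B *
    ((Fintype.card (State S d) + Fintype.card (Jump S d)) * B + 1) with hC₂
  have hC₂0 : 0 ≤ C₂ := by positivity
  have hC₁0 : 0 ≤ stepConst S d B Λ := by unfold stepConst; positivity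
  have h3 : |push (stepMatrix μh θ s rate n) (q (s n)) x -
      (q (s n) x + Δ * drift (μh (s n)) (q (s n)) x)| ≤ stepConst S d B Λ * Δ ^ 2 := by
    rw [← push_firstOrder]
    unfold push
    rw [← Finset.sum_sub_distrib]
    calc _ ≤ ∑ y, q (s n) y * (stepConst S d B Λ * Δ ^ 2) := by
          refine (Finset.abs_sum_le_sum_abs _ _).trans (Finset.sum_le_sum fun y _ => ?_)
          rw [← mul_sub, abs_mul, abs_of_nonneg (hq0.1 y)]
          exact mul_le_mul_of_nonneg_left
            (abs_stepMatrix_sub_firstOrder_le hθ hB hBΛ hμh hs hrate hn y x) (hq0.1 y)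
      _ = _ := by rw [← Finset.sum_mul, hq0.2, one_mul]
  have h4 : |Δ * (drift (μ (s n)) (q (s n)) x - drift (μh (s n)) (q (s n)) x)| ≤
      Δ * (2 * A) := by
    rw [abs_mul, abs_of_pos hΔ]
    exact mul_le_mul_of_nonneg_left h2 hΔ.le
  have h5 : |q (s (n + 1)) x - push (stepMatrix μh θ s rate n) (q (s n)) x| ≤
      C₂ * Δ ^ 2 + stepConst S d B Λ * Δ ^ 2 + Δ * (2 * A) := by
    rw [abs_le] at h1 h3 h4 ⊢
    constructor <;> linarith [h1.1, h1.2, h3.1, h3.2, h4.1, h4.2]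
  have h6 : 0 ≤ (C₂ + stepConst S d B Λ) * (Δ * A) := by positivity
  have h7 : 0 ≤ Δ ^ 2 := sq_nonneg _
  linarith

/-- The two bounds behind the theorem, for a backward process `q` and a two-stage scheme `r`. If all
steps are at most `κ₀`, the divergence is at most the initial χ²-divergence plus the accumulated
errors; whatever the steps are, it grows at most linearly in time. -/
lemma exists_klDiv_le (S d : ℕ) [NeZero S] {θ m B Λ c₀ : ℝ} (hθ : θ ∈ Ioc (0 : ℝ) (1 / 2))
    (hm : 0 < m) (hB : 0 < B) (hBΛ : B ≤ Λ) (hc₀ : 0 < c₀) :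
    ∃ κ₀ G : ℝ, 0 < κ₀ ∧ 0 < G ∧ ∀ (L : ℝ) (μ μh : ℝ → Jump S d → State S d → ℝ)
      (N : ℕ) (s : ℕ → ℝ) (rate : ℕ → State S d → State S d → Jump S d → ℝ)
      (q : ℝ → State S d → ℝ) (π : State S d → ℝ) (E : State S d → State S d → Prop) (ε : ℝ),
      IsLipschitzRate B L μ → IsLipschitzRate B L μh → IsGrid L N s →
      IsSecondStage Λ B N s μh rate →
      (∀ s ∈ Icc 0 L, q s ∈ stdSimplex ℝ (State S d)) →
      (∀ s ∈ Icc 0 L, ∀ x,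
        HasDerivWithinAt (fun s => q s x) (drift (μ s) (q s) x) (Icc 0 L) s) →
      π ∈ stdSimplex ℝ (State S d) → (∀ x, c₀ ≤ π x) →
      IsCutConnected E → (∀ y x, E y x → ∃ ν : Jump S d, x = y + ν ∧
        ∀ s ∈ Icc 0 L, m ≤ μh s ν y) →
      (∀ n < N, ∑ y, q (s n) y * ∑ ν, |μ (s n) ν y - μh (s n) ν y| ≤ ε) →
      (∀ κ ≤ κ₀, (∀ n < N, s (n + 1) - s n ≤ κ) →
        klDiv (toMeasure (q L)) (twoStageLaw μh θ s rate (toMeasure π) N) ≤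
          ENNReal.ofReal (chiSq (fun x => q 0 x - π x) π + G * (L * (κ ^ 2 + ε)))) ∧
      klDiv (toMeasure (q L)) (twoStageLaw μh θ s rate (toMeasure π) N) ≤
        ENNReal.ofReal (-Real.log c₀ + Fintype.card (Jump S d) * Λ * L) := by
  have hΛ : 0 < Λ := hB.trans_le hBΛ
  set n₀ : ℝ := (Fintype.card (State S d) : ℝ) with hn₀
  set K : ℝ := (Fintype.card (Jump S d) : ℝ) with hK
  have hn₀pos : 0 < n₀ := by
    rw [hn₀]
    exact_mod_cast Fintype.card_pos
  have hK0 : 0 ≤ K := by positivity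
  set C₁ := stepConst S d B Λ with hC₁
  have hC₁0 : 0 ≤ C₁ := by rw [hC₁]; unfold stepConst; positivity
  set b := K * Λ with hb
  have hb0 : 0 ≤ b := by positivity
  set c₁ := c₀ * (m / 2 / (m / 2 + b)) ^ Fintype.card (State S d) with hc₁
  have hc₁pos : 0 < c₁ := by positivity
  set D := 2 * K * B * ((n₀ + K) * B + 1) + C₁ + 2 with hD
  have hDpos : 0 < D := by positivity
  set G₀ := 4 * n₀ ^ 3 * D ^ 2 / (c₁ ^ 2 * (m / 2)) with hG₀
  have hG₀pos : 0 < G₀ := by positivity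
  refine ⟨min (m / (2 * (C₁ + 1))) (1 / (2 * (m / 2 + b))), G₀ * (2 + 2 * (K * B)),
    by positivity, by positivity, ?_⟩
  intro L μ μh N s rate q π E ε hμ hμh hs hrate hq hder hπ hπc hE hEm hε
  have hL : (0 : ℝ) ≤ L := (hs.mem_Icc le_rfl).1.trans (hs.mem_Icc le_rfl).2
  have hprobπ := isProbabilityMeasure_toMeasure hπ
  have hprobq := isProbabilityMeasure_toMeasure (hq L ⟨hL, le_rfl⟩)
  have hprob := isProbabilityMeasure_twoStageLaw μh θ s rate (toMeasure π)
  have hπreal : ∀ x, (toMeasure π).real {x} = π x := toMeasure_real_singleton hπ.1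
  have hqreal : ∀ x, (toMeasure (q L)).real {x} = q L x :=
    toMeasure_real_singleton (hq L ⟨hL, le_rfl⟩).1
  set r : ℕ → State S d → ℝ := fun n x => (twoStageLaw μh θ s rate (toMeasure π) n).real {x}
    with hr
  have hr0 : ∀ x, r 0 x = π x := hπreal
  refine ⟨fun κ hκ hΔκ => ?_, ?_⟩
  · have hsmall : ∀ n < N, C₁ * (s (n + 1) - s n) ≤ m / 2 ∧
        (m / 2 + b) * (s (n + 1) - s n) ≤ 1 / 2 := by
      intro n hn
      have h1 := (hΔκ n hn).trans (hκ.trans (min_le_left _ _))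
      have h2 := (hΔκ n hn).trans (hκ.trans (min_le_right _ _))
      have hΔ : 0 < s (n + 1) - s n := sub_pos.2 (hs.2.2 n hn)
      rw [le_div_iff₀ (by positivity)] at h1 h2
      exact ⟨by linarith, by linarith⟩
    have hΔ : ∀ n < N, 0 < s (n + 1) - s n := fun n hn => sub_pos.2 (hs.2.2 n hn)
    have hstay : ∀ n < N, ∀ x, 1 - b * (s (n + 1) - s n) ≤ stepMatrix μh θ s rate n x x :=
      fun n hn x => by
        refine le_trans ?_ (exp_neg_le_stepMatrix_self hΛ.le hs hrate hn x)
        linarith [Real.add_one_le_exp (-(K * Λ * (s (n + 1) - s n)))]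
    have hedge : ∀ n < N, ∀ y x, y ≠ x → E y x →
        m / 2 * (s (n + 1) - s n) ≤ stepMatrix μh θ s rate n y x := by
      intro n hn y x hyx hyE
      obtain ⟨ν, rfl, hν⟩ := hEm y x hyE
      have h1 := (abs_le.1 (abs_stepMatrix_sub_firstOrder_le hθ hB.le hBΛ hμh hs hrate hn y
        (y + ν))).1
      have h2 : firstOrder (fun ν => (s (n + 1) - s n) * μh (s n) ν y) y (y + ν) =
          (s (n + 1) - s n) * μh (s n) ν y := by
        rw [firstOrder, if_neg hyx.symm, zero_add, add_sub_cancel_left, extendZero_coe]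
      rw [h2] at h1
      have h3 := mul_le_mul_of_nonneg_left (hν _ (hs.mem_Icc hn.le)) (hΔ n hn).le
      have h4 := mul_le_mul_of_nonneg_right (hsmall n hn).1 (hΔ n hn).le
      linarith
    have hstoch : ∀ n < N, IsStochastic (stepMatrix μh θ s rate n) := fun n _ =>
      isStochastic_stepMatrix μh θ s rate n
    have hrsucc : ∀ n < N, ∀ x, r (n + 1) x = push (stepMatrix μh θ s rate n) (r n) x :=
      fun n _ x => twoStageLaw_succ_real μh θ s rate (toMeasure π) n x
    have hrsum : ∀ n ≤ N, ∑ x, r n x = 1 := fun n _ => sum_measureReal_singleton_eq_one _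
    have hrlow : ∀ n ≤ N, ∀ x, c₁ ≤ r n x := by
      intro n hn x
      have h := le_sum_of_isCutConnected hE (half_pos hm) hb0 hc₀.le
        (fun n _ x => measureReal_nonneg) hrsum (fun x => (hπc x).trans_eq (hr0 x).symm)
        hrsucc hstoch (fun n hn => (hΔ n hn).le)
        (fun n hn => (hsmall n hn).2.trans (by norm_num)) hstay hedge
        (Fintype.card (State S d)) {x} (Finset.singleton_nonempty x) (by simp) n hn
      rwa [Finset.sum_singleton] at h
    have hAB : ∀ n < N, ∑ y, q (s n) y * ∑ ν, |μ (s n) ν y - μh (s n) ν y| ≤ K * B := by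
      intro n hn
      have hsn := hs.mem_Icc hn.le
      calc ∑ y, q (s n) y * ∑ ν, |μ (s n) ν y - μh (s n) ν y|
          ≤ ∑ y, q (s n) y * (K * B) := by
            refine Finset.sum_le_sum fun y _ => mul_le_mul_of_nonneg_left ?_ ((hq _ hsn).1 y)
            calc _ ≤ ∑ _ν : Jump S d, B := Finset.sum_le_sum fun ν _ => abs_le.2
                  ⟨by linarith [(hμ _ hsn ν y).1, (hμh _ hsn ν y).2.1],
                    by linarith [(hμ _ hsn ν y).2.1, (hμh _ hsn ν y).1]⟩
              _ = _ := by rw [Finset.sum_const, Finset.card_univ, nsmul_eq_mul]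
        _ = K * B := by rw [← Finset.sum_mul, (hq _ hsn).2, one_mul]
    have hchi := chiSq_le_chiSq_add_sum hE (q := fun n => q (s n)) (r := r)
      (Δ := fun n => s (n + 1) - s n)
      (A := fun n => ∑ y, q (s n) y * ∑ ν, |μ (s n) ν y - μh (s n) ν y|) (half_pos hm) hc₁pos
      hstoch hrlow hrsum (fun n hn => (hq _ (hs.mem_Icc hn)).2) hrsucc hΔ
      (fun n hn => by
        have := (hsmall n hn).2
        have := mul_nonneg hb0 (hΔ n hn).le
        linarith)
      (fun n hn x => by
        have := hstay n hn x
        have := (hsmall n hn).2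
        have := mul_nonneg hm.le (hΔ n hn).le
        linarith) hedge
      (fun n hn x => abs_sub_push_stepMatrix_le hθ hB.le hBΛ hμ hμh hs hrate hq hder hn x)
      N le_rfl
    have hsum : ∑ n ∈ Finset.range N, (s (n + 1) - s n) * ((s (n + 1) - s n) +
        ∑ y, q (s n) y * ∑ ν, |μ (s n) ν y - μh (s n) ν y|) ^ 2 ≤
        L * ((2 + 2 * (K * B)) * (κ ^ 2 + ε)) := by
      calc _ ≤ ∑ n ∈ Finset.range N, (s (n + 1) - s n) * ((2 + 2 * (K * B)) * (κ ^ 2 + ε)) := by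
            refine Finset.sum_le_sum fun n hn => ?_
            have hn := Finset.mem_range.1 hn
            refine mul_le_mul_of_nonneg_left ?_ (hΔ n hn).le
            have h1 := hAB n hn
            have h2 := hε n hn
            have h3 := hΔκ n hn
            have h4 := hΔ n hn
            have h5 : 0 ≤ ∑ y, q (s n) y * ∑ ν, |μ (s n) ν y - μh (s n) ν y| :=
              Finset.sum_nonneg fun y _ => mul_nonneg ((hq _ (hs.mem_Icc hn.le)).1 y)
                (Finset.sum_nonneg fun ν _ => abs_nonneg _)
            set A := ∑ y, q (s n) y * ∑ ν, |μ (s n) ν y - μh (s n) ν y|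
            set Δ := s (n + 1) - s n
            have h6 : Δ ^ 2 ≤ κ ^ 2 := by gcongr
            -- The estimation error is bounded, so its square costs only one factor `ε`.
            have h7 : A ^ 2 ≤ K * B * ε := by
              rw [sq]
              exact mul_le_mul h1 h2 h5 (by positivity)
            have h8 : 0 ≤ K * B * κ ^ 2 := by positivity
            linarith [sq_nonneg (Δ - A), h5.trans h2]
        _ = _ := by
            rw [← Finset.sum_mul, Finset.sum_range_sub, hs.1, hs.2.1, sub_zero]
    refine (klDiv_le_chiSq _ _ fun x => hc₁pos.trans_le (hrlow N le_rfl x)).trans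
      (ENNReal.ofReal_le_ofReal ?_)
    simp only [hqreal]
    have h0 : chiSq (q (s 0) - r 0) (r 0) = chiSq (fun x => q 0 x - π x) π := by
      rw [hs.1, show r 0 = π from funext hr0]
      rfl
    have hNL : chiSq (q (s N) - r N) (r N) = chiSq (fun x => q L x - r N x) (r N) := by
      rw [hs.2.1]
      rfl
    have hfin := mul_le_mul_of_nonneg_left hsum hG₀pos.le
    calc chiSq (fun x => q L x - r N x) (r N)
        ≤ chiSq (fun x => q 0 x - π x) π + G₀ * _ := by
          rw [← hNL, ← h0]
          exact hchi
      _ ≤ _ := by linarith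
  · have h := klDiv_le_neg_log (toMeasure (q L)) (twoStageLaw μh θ s rate (toMeasure π) N)
      (c := c₀ * Real.exp (-(K * Λ * L))) (by positivity) fun x => by
        have := exp_neg_le_twoStageLaw (θ := θ) hΛ.le hs hrate
          (fun x => (hπc x).trans_eq (hπreal x).symm) x N le_rfl
        rwa [hs.2.1] at this
    rwa [Real.log_mul hc₀.ne' (Real.exp_pos _).ne', Real.log_exp, neg_add, neg_neg] at h

lemma entropyError_nonneg {T : ℝ} {p : ℝ → State S d → ℝ} {μ μh : ℝ → Jump S d → State S d → ℝ}
    {s : ℝ} (hp : ∀ x, 0 ≤ p (T - s) x)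
    (h : ∀ ν y, (0 < μ s ν y ∧ 0 < μh s ν y) ∨ (μ s ν y = 0 ∧ μh s ν y = 0)) :
    0 ≤ entropyError T p μ μh s := by
  refine Finset.sum_nonneg fun y _ => mul_nonneg (hp y) (Finset.sum_nonneg fun ν _ => ?_)
  rcases h ν y with ⟨h1, h2⟩ | ⟨h1, h2⟩
  · have h3 := Real.log_le_sub_one_of_pos (div_pos h2 h1)
    rw [← inv_div (μ s ν y), Real.log_inv, inv_div] at h3
    have h4 := mul_le_mul_of_nonneg_left h3 h1.le
    have h5 : μ s ν y * (μh s ν y / μ s ν y - 1) = μh s ν y - μ s ν y := by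
      field_simp
    linarith
  · rw [h1, h2]
    simp

end Assembly

end ThetaRK

theorem mainTheorem2 (S d : ℕ) [NeZero S] (pinf : State S d → ℝ) (θ m M C₀ : ℝ)
    (hpinf : pinf ∈ stdSimplex ℝ (State S d))
    (hθ : θ ∈ Ioc (0 : ℝ) (1 / 2)) (hm : 0 < m) :
    ∃ C : ℝ, 0 < C ∧
      ∀ (T δ : ℝ) (Q : ℝ → Matrix (State S d) (State S d) ℝ) (p : ℝ → State S d → ℝ)
        (sh : ℝ → State S d → State S d → ℝ) (N : ℕ) (s : ℕ → ℝ) (κ ε₁ ε₂ : ℝ),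
        0 ≤ δ → δ < T →
        IsForwardProcess T Q p →
        (∀ t ∈ Icc δ T, ∀ x, 0 < p t x) →
        (∀ t ∈ Icc δ T, IsUniqueStationary (Q t) pinf) →
        klDiv (toMeasure (p T)) (toMeasure pinf) ≤ ENNReal.ofReal (C₀ * Real.exp (-T)) →
        RegularIntensities m M T δ p (intensity T Q (score p)) (intensity T Q sh) →
        IsGrid (T - δ) N s →
        IsGreatest {Δ : ℝ | ∃ n < N, Δ = s (n + 1) - s n} κ →
        EstimationErrorLE ε₁ ε₂ T θ N s p (intensity T Q (score p)) (intensity T Q sh) →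
        (CombinedIntensityNonneg (intensity T Q sh) θ N s
            (algorithmLaw (intensity T Q sh) θ s (toMeasure pinf)) →
          klDiv (toMeasure (p δ)) (algorithmLaw (intensity T Q sh) θ s (toMeasure pinf) N) ≤
            ENNReal.ofReal (C * (Real.exp (-T) + (ε₁ + ε₂) * T + κ ^ 2 * T))) ∧
        (CombinedIntensityNonneg (intensity T Q sh) θ N s
            (interpolatingLaw (intensity T Q sh) θ s (toMeasure pinf)) →
          klDiv (toMeasure (p δ)) (interpolatingLaw (intensity T Q sh) θ s (toMeasure pinf) N) ≤
            ENNReal.ofReal (C * (Real.exp (-T) + (ε₁ + ε₂) * T + κ ^ 2 * T))) := by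
  have hprobinf := isProbabilityMeasure_toMeasure hpinf
  by_cases hpos : ∀ x, 0 < pinf x
  swap
  -- A finite divergence of the positive vector `p T` from `pinf` forces `pinf` to be positive.
  · refine ⟨1, one_pos, ?_⟩
    intro T δ Q p sh N s κ ε₁ ε₂ hδ hδT hfwd hp hst hkl
    exfalso
    apply hpos
    intro x
    refine lt_of_le_of_ne (hpinf.1 x) fun hx => ?_
    have hT : T ∈ Icc δ T := ⟨hδT.le, le_rfl⟩
    have hac := (klDiv_ne_top_iff.1 (ne_top_of_le_ne_top ENNReal.ofReal_ne_top hkl)).1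
    have h1 : (toMeasure pinf) {x} = 0 := by
      rw [← ofReal_measureReal, toMeasure_real_singleton hpinf.1, ← hx, ENNReal.ofReal_zero]
    have h2 := toMeasure_real_singleton (fun x => (hp T hT x).le) x
    rw [measureReal_def, hac h1] at h2
    exact (hp T hT x).ne h2
  obtain ⟨c₀, hc₀, hc₀le⟩ : ∃ c₀ : ℝ, 0 < c₀ ∧ ∀ x, c₀ ≤ pinf x := by
    obtain ⟨x₀, hx₀⟩ := Finite.exists_min pinf
    exact ⟨pinf x₀, hpos x₀, hx₀⟩
  have hpinf1 : ∀ x, pinf x ≤ 1 := fun x => by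
    rw [← hpinf.2]
    exact Finset.single_le_sum (fun y _ => hpinf.1 y) (Finset.mem_univ x)
  set B := |M| + 1 with hBdef
  have hB : 0 < B := by positivity
  have hθ0 := hθ.1
  have hBΛ : B ≤ B / θ := by
    rw [le_div_iff₀ hθ0]
    exact mul_le_of_le_one_right hB.le (by linarith [hθ.2])
  obtain ⟨κ₀, G, hκ₀, hG, hmain⟩ := exists_klDiv_le S d hθ hm hB hBΛ hc₀
  set K : ℝ := (Fintype.card (Jump S d) : ℝ) with hK
  have hK0 : 0 ≤ K := by positivity
  have hlog : 0 ≤ -Real.log c₀ := by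
    have : c₀ ≤ 1 := (hc₀le 0).trans (hpinf1 0)
    linarith [Real.log_nonpos hc₀.le this]
  set H := -Real.log c₀ + K * (B / θ) with hH
  have hH0 : 0 ≤ H := by positivity
  refine ⟨4 / c₀ * |C₀| + G + 2 * H * Real.exp 1 + 2 * H / κ₀ ^ 2, by positivity, ?_⟩
  intro T δ Q p sh N s κ ε₁ ε₂ hδ hδT hfwd hp hst hkl hreg hgrid hκ herr
  set L := T - δ with hL
  have hT0 : 0 < T := hδ.trans_lt hδT
  have hL0 : 0 < L := sub_pos.2 hδT
  have hTmem : T ∈ Icc δ T := ⟨hδT.le, le_rfl⟩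
  have hmem : ∀ u ∈ Icc 0 L, T - u ∈ Icc δ T := fun u hu =>
    ⟨by linarith [hu.2], by linarith [hu.1]⟩
  have hQ : ∀ t ∈ Icc δ T, IsRateMatrix (Q t) := fun t ht =>
    hfwd.1 t ⟨hδ.trans ht.1, ht.2⟩
  have hzero : ∀ ν y, ¬ IsCharged L T p (intensity T Q (score p)) ν y → ∀ u ∈ Icc 0 L, ∀ sc,
      intensity T Q sc u ν y = 0 := fun ν y h u hu sc =>
    intensity_eq_zero_of_not_isCharged hQ hp h hu sc
  have hμ : IsLipschitzRate B L (intensity T Q (score p)) :=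
    isLipschitzRate_of_dichotomy hm fun ν y =>
      (em (IsCharged L T p (intensity T Q (score p)) ν y)).imp (fun h => (hreg ν y h).1)
        fun h u hu => hzero ν y h u hu _
  have hμh : IsLipschitzRate B L (intensity T Q sh) :=
    isLipschitzRate_of_dichotomy hm fun ν y =>
      (em (IsCharged L T p (intensity T Q (score p)) ν y)).imp (fun h => (hreg ν y h).2)
        fun h u hu => hzero ν y h u hu _
  have hsimplex : ∀ u ∈ Icc 0 L, p (T - u) ∈ stdSimplex ℝ (State S d) := fun u hu =>
    hfwd.2.1 _ ⟨hδ.trans (hmem u hu).1, (hmem u hu).2⟩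
  have hcut : IsCutConnected fun y x : State S d => ∃ ν : Jump S d, x = y + ν ∧
      IsCharged L T p (intensity T Q (score p)) ν y := by
    intro A hA hAu
    obtain ⟨y, hy, x, hx, hyx⟩ :=
      exists_pos_rate_of_isUniqueStationary (hQ T hTmem) hpinf hpos (hst T hTmem) A hA hAu
    have hne : x - y ≠ 0 := sub_ne_zero.2 fun h => hy (h ▸ hx)
    refine ⟨y, hy, x, hx, ⟨x - y, hne⟩, by simp, 0, ⟨le_rfl, hL0.le⟩, ?_⟩
    simp only [intensity, score, sub_zero, add_sub_cancel]
    exact mul_pos (mul_pos (div_pos (hp T hTmem x) (hp T hTmem y)) hyx) (hp T hTmem y)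
  obtain ⟨n₀, hn₀, hκn₀⟩ := hκ.1
  have hκ0 : 0 < κ := by
    rw [hκn₀]
    exact sub_pos.2 (hgrid.2.2 n₀ hn₀)
  have hΔκ : ∀ n < N, s (n + 1) - s n ≤ κ := fun n hn => hκ.2 ⟨n, hn, rfl⟩
  have hsn₀ := hgrid.mem_Icc hn₀.le
  have hε₁ : 0 ≤ ε₁ := by
    refine le_trans (entropyError_nonneg (fun x => (hp _ (hmem _ hsn₀) x).le) fun ν y => ?_)
      (herr n₀ hn₀ _ (Or.inl rfl)).1
    by_cases h : IsCharged L T p (intensity T Q (score p)) ν y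
    · exact Or.inl ⟨hm.trans_le ((hreg ν y h).1.2 _ hsn₀).1,
        hm.trans_le ((hreg ν y h).2.2 _ hsn₀).1⟩
    · exact Or.inr ⟨hzero ν y h _ hsn₀ _, hzero ν y h _ hsn₀ _⟩
  have hε₂ : 0 ≤ ε₂ :=
    le_trans (Finset.sum_nonneg fun y _ => mul_nonneg (hp _ (hmem _ hsn₀) y).le
      (Finset.sum_nonneg fun ν _ => abs_nonneg _)) (herr n₀ hn₀ _ (Or.inl rfl)).2
  have hinit : chiSq (fun x => p T x - pinf x) pinf ≤ 4 / c₀ * |C₀| * Real.exp (-T) := by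
    have hpT := hsimplex 0 ⟨le_rfl, hL0.le⟩
    rw [sub_zero] at hpT
    have hprobT := isProbabilityMeasure_toMeasure hpT
    have hpT1 : ∀ x, p T x ≤ 1 := fun x => by
      rw [← hpT.2]
      exact Finset.single_le_sum (fun y _ => hpT.1 y) (Finset.mem_univ x)
    refine (chiSq_le_sum_klFun hc₀ hc₀le hpinf1 hpT.1 hpT1).trans ?_
    rw [mul_assoc]
    refine mul_le_mul_of_nonneg_left ?_ (by positivity)
    rw [klDiv_eq_ofReal_sum _ _ fun x => by
      rw [toMeasure_real_singleton hpinf.1]; exact hpos x] at hkl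
    simp only [toMeasure_real_singleton hpinf.1, toMeasure_real_singleton hpT.1] at hkl
    have h1 : ENNReal.ofReal (C₀ * Real.exp (-T)) ≤ ENNReal.ofReal (|C₀| * Real.exp (-T)) :=
      ENNReal.ofReal_le_ofReal
        (mul_le_mul_of_nonneg_right (le_abs_self _) (Real.exp_pos _).le)
    exact (ENNReal.ofReal_le_ofReal_iff (by positivity)).1 (hkl.trans h1)
  have key : ∀ rate, IsSecondStage (B / θ) B N s (intensity T Q sh) rate →
      klDiv (toMeasure (p δ)) (twoStageLaw (intensity T Q sh) θ s rate (toMeasure pinf) N) ≤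
        ENNReal.ofReal ((4 / c₀ * |C₀| + G + 2 * H * Real.exp 1 + 2 * H / κ₀ ^ 2) *
          (Real.exp (-T) + (ε₁ + ε₂) * T + κ ^ 2 * T)) := by
    intro rate hrate
    have h := hmain L (intensity T Q (score p)) (intensity T Q sh) N s rate
      (fun u => p (T - u)) pinf _ ε₂ hμ hμh hgrid hrate hsimplex
      (fun u hu x => hasDerivWithinAt_backward hδ hfwd hp hu x) hpinf hc₀le hcut
      (fun y x ⟨ν, hx, hν⟩ => ⟨ν, hx, fun u hu => ((hreg ν y hν).2.2 u hu).1⟩)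
      (fun n hn => (herr n hn _ (Or.inl rfl)).2)
    simp only [hL, sub_sub_cancel, sub_zero] at h
    rw [← hL] at h
    have hLT : L ≤ T := by linarith
    have hexp := Real.exp_pos (-T)
    have hεT : 0 ≤ (ε₁ + ε₂) * T := by positivity
    have hκT : 0 ≤ κ ^ 2 * T := by positivity
    have hC1 : 0 ≤ 4 / c₀ * |C₀| := by positivity
    have hC3 : 0 ≤ 2 * H * Real.exp 1 := by positivity
    have hC4 : 0 ≤ 2 * H / κ₀ ^ 2 := by positivity
    set R := Real.exp (-T) + (ε₁ + ε₂) * T + κ ^ 2 * T with hR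
    have hR0 : 0 ≤ R := by positivity
    have p1 := mul_nonneg hC1 hR0
    have p2 := mul_nonneg hG.le hR0
    have p3 := mul_nonneg hC3 hR0
    have p4 := mul_nonneg hC4 hR0
    by_cases hsmall : κ ≤ κ₀
    · refine (h.1 κ hsmall hΔκ).trans (ENNReal.ofReal_le_ofReal ?_)
      have h1 : 4 / c₀ * |C₀| * Real.exp (-T) ≤ 4 / c₀ * |C₀| * R :=
        mul_le_mul_of_nonneg_left (by linarith) hC1
      have h2 : G * (L * (κ ^ 2 + ε₂)) ≤ G * R := by
        refine mul_le_mul_of_nonneg_left ?_ hG.le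
        have h3 : L * (κ ^ 2 + ε₂) ≤ T * (κ ^ 2 + ε₂) :=
          mul_le_mul_of_nonneg_right hLT (by positivity)
        have h4 : 0 ≤ ε₁ * T := by positivity
        linarith
      linarith
    · refine h.2.trans (ENNReal.ofReal_le_ofReal ?_)
      have h1 : -Real.log c₀ + K * (B / θ) * L ≤ H * (1 + T) := by
        have h2 : K * (B / θ) * L ≤ K * (B / θ) * T :=
          mul_le_mul_of_nonneg_left hLT (by positivity)
        have h3 : 0 ≤ K * (B / θ) := by positivity
        have h4 : 0 ≤ -Real.log c₀ * T := mul_nonneg hlog hT0.le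
        rw [hH]
        linarith
      -- For short times the term `exp (-T)` is bounded below, for long times `κ² T` is at least
      -- `κ₀² T`.
      rcases le_total T 1 with hT1 | hT1
      · have h2 : 2 * H ≤ 2 * H * Real.exp 1 * R := by
          have h3 : 1 ≤ Real.exp 1 * Real.exp (-T) := by
            rw [← Real.exp_add]
            exact Real.one_le_exp (by linarith)
          have h4 : 1 ≤ Real.exp 1 * R := h3.trans
            (mul_le_mul_of_nonneg_left (by linarith) (Real.exp_pos _).le)
          calc 2 * H ≤ 2 * H * (Real.exp 1 * R) := le_mul_of_one_le_right (by positivity) h4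
            _ = _ := by ring
        have h5 : H * (1 + T) ≤ H * 2 := mul_le_mul_of_nonneg_left (by linarith) hH0
        linarith
      · have h2 : 2 * H * T ≤ 2 * H / κ₀ ^ 2 * R := by
          have h3 : κ₀ ^ 2 * T ≤ R := by
            have : κ₀ ^ 2 * T ≤ κ ^ 2 * T := by
              have := (not_le.1 hsmall).le
              gcongr
            linarith
          calc 2 * H * T = 2 * H / κ₀ ^ 2 * (κ₀ ^ 2 * T) := by field_simp
            _ ≤ _ := mul_le_mul_of_nonneg_left h3 hC4
        have h5 : H * (1 + T) ≤ H * (2 * T) := mul_le_mul_of_nonneg_left (by linarith) hH0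
        linarith
  exact ⟨fun _ => key _ (isSecondStage_algorithmIntensity hθ hB.le hμh hgrid),
    fun _ => key _ (isSecondStage_combinedIntensity hθ hB.le hμh hgrid)⟩
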